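/- **Conventions.** Let $l_\infty$ be the algebra of bounded (real or complex) sequences $x=\{x(k)\}_{k\ge 0}$, and for $x\in l_\infty$ let $\mu(x)$ be its decreasing rearrangement, $\mu(k,x)=\inf\{\|x\,1_{\mathbb{N}\setminus A}\|_\infty : |A|\le k\}$. A *symmetric sequence space* is an ideal $I$ of $l_\infty$ with a complete norm $\|\cdot\|_I$ such that $x\in I$, $y\in l_\infty$ and $\mu(y)=\mu(x)$ imply $y\in I$ and $\|y\|_I=\|x\|_I$. An *Orlicz function* is an even convex function $M:\mathbb{R}\to\mathbb{R}$ with $M(0)=0$. It is *$p$-convex* if $t\mapsto M(t^{1/p})$ is convex on $(0,\infty)$, and *$q$-concave* if $t\mapsto M(t^{1/q})$ is concave on $(0,\infty)$. Put $\|x\|_{l_M}=\inf\{\lambda>0:\sum_k M(|x(k)|/\lambda)\le 1\}$. Let $\mathcal{O}_{p,2}$ be the set of $p$-convex and $2$-concave Orlicz functions $M$ with $M(1)=1$, equipped with the topology of pointwise convergence and its Borel $\sigma$-algebra. **Theorem** (Raynaud–Schütt for $1\le p\le 2$). Let $1\le p\le 2$. The space $\mathcal{O}_{p,2}$ is compact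 and metrizable. If a nonzero symmetric sequence space $I$ embeds isomorphically into $L_p(0,1)$ (that is, there are a linear map $T:I\to L_p(0,1)$ over the same scalars and constants $c,c'>0$ such that $c\|x\|_I\le\|Tx\|_p\le c'\|x\|_I$ for all $x\in I$), then there exist a Radon probability measure $\nu$ on $\mathcal{O}_{p,2}$ and a constant $C>0$ such that every finitely supported sequence $x$ belongs to $I$, the function $M\mapsto\|x\|_{l_M}^p$ is $\nu$-integrable, and $$C\,\|x\|_I\;\le\;\Big(\int_{\mathcal{O}_{p,2}}\|x\|_{l_M}^p\,d\nu(M)\Big)^{1/p}\;\le\; C^{-1}\,\|x\|_I .$$ -/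

import Mathlib

open scoped ENNReal

noncomputable section

/-- The algebra `l_∞` of bounded scalar sequences. -/
abbrev BddSeq (𝕜 : Type*) [RCLike 𝕜] : Type _ := lp (fun _ : ℕ => 𝕜) ∞

/-- The decreasing rearrangement `μ(x)` of a bounded sequence `x`:
`μ(k, x) = inf { ‖x · 1_{ℕ ∖ A}‖_∞ : |A| ≤ k }`. -/
def decRearr {𝕜 : Type*} [RCLike 𝕜] (x : BddSeq 𝕜) (k : ℕ) : ℝ :=
  sInf {s : ℝ | ∃ A : Finset ℕ, A.card ≤ k ∧ ∀ j ∉ A, ‖x j‖ ≤ s}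

/-- A symmetric sequence space: an ideal `I` of the algebra `l_∞`, with a complete norm, such that
`x ∈ I` and `μ(y) = μ(x)` imply `y ∈ I` and `‖y‖_I = ‖x‖_I`.
(The bound `‖a x‖_I ≤ ‖a‖_∞ ‖x‖_I` for `a ∈ l_∞` follows from these properties.) -/
structure SymmSeqSpace (𝕜 : Type*) [RCLike 𝕜] where
  /-- the underlying ideal of `l_∞` -/
  ideal : Ideal (BddSeq 𝕜)
  /-- the norm `‖·‖_I` (not the one inherited from `l_∞`) -/
  nrm : Seminorm 𝕜 ideal
  eq_zero_of_nrm_eq_zero : ∀ x : ideal, nrm x = 0 → x = 0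
  complete : ∀ u : ℕ → ideal,
    (∀ ε : ℝ, 0 < ε → ∃ N : ℕ, ∀ m ≥ N, ∀ n ≥ N, nrm (u m - u n) < ε) →
      ∃ x : ideal, Filter.Tendsto (fun n => nrm (u n - x)) Filter.atTop (nhds 0)
  symm : ∀ (x : ideal) (y : BddSeq 𝕜), decRearr y = decRearr (x : BddSeq 𝕜) →
    ∃ hy : y ∈ ideal, nrm ⟨y, hy⟩ = nrm x

/-- `I` embeds isomorphically into `L_p(0,1)`: there is a linear map `T : I → L_p(0,1)` with
`c ‖x‖_I ≤ ‖T x‖_p ≤ C ‖x‖_I` for some constants `c, C > 0`. -/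
def SymmSeqSpace.EmbedsInLp {𝕜 : Type*} [RCLike 𝕜] (I : SymmSeqSpace 𝕜) (p : ℝ) : Prop :=
  ∃ T : I.ideal →ₗ[𝕜] MeasureTheory.Lp 𝕜 (ENNReal.ofReal p)
      (MeasureTheory.volume.restrict (Set.Ioo (0 : ℝ) 1)),
    ∃ c C : ℝ, 0 < c ∧ 0 < C ∧ ∀ x : I.ideal, c * I.nrm x ≤ ‖T x‖ ∧ ‖T x‖ ≤ C * I.nrm x

/-- An Orlicz function: an even convex function on `ℝ` vanishing at `0`. -/
structure IsOrlicz (M : ℝ → ℝ) : Prop where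
  convex : ConvexOn ℝ Set.univ M
  even : ∀ t, M (-t) = M t
  zero : M 0 = 0

/-- `M` is `p`-convex: `t ↦ M (t ^ (1/p))`, `t > 0`, is convex. -/
def OrliczPConvex (p : ℝ) (M : ℝ → ℝ) : Prop :=
  ConvexOn ℝ (Set.Ioi 0) fun t : ℝ => M (t ^ (1 / p))

/-- `M` is `q`-concave: `t ↦ M (t ^ (1/q))`, `t > 0`, is concave. -/
def OrliczQConcave (q : ℝ) (M : ℝ → ℝ) : Prop :=
  ConcaveOn ℝ (Set.Ioi 0) fun t : ℝ => M (t ^ (1 / q))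

/-- The set `𝓞_{p,q}` of `p`-convex, `q`-concave Orlicz functions `M` with `M 1 = 1`. -/
def OrliczClass (p q : ℝ) : Type :=
  {M : ℝ → ℝ // IsOrlicz M ∧ OrliczPConvex p M ∧ OrliczQConcave q M ∧ M 1 = 1}

instance (p q : ℝ) : CoeFun (OrliczClass p q) fun _ => ℝ → ℝ := ⟨Subtype.val⟩

/-- The topology of pointwise convergence on `𝓞_{p,q}`. -/
instance (p q : ℝ) : TopologicalSpace (OrliczClass p q) :=
  TopologicalSpace.induced (fun M : OrliczClass p q => (M : ℝ → ℝ)) Pi.topologicalSpace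

/-- `𝓞_{p,q}` carries its Borel `σ`-algebra. -/
instance (p q : ℝ) : MeasurableSpace (OrliczClass p q) := borel _

instance (p q : ℝ) : BorelSpace (OrliczClass p q) := ⟨rfl⟩

/-- The Luxemburg norm `‖x‖_{l_M} = inf { l > 0 : ∑ₖ M (|x k| / l) ≤ 1 }`. -/
def orliczNorm {𝕜 : Type*} [RCLike 𝕜] (M : ℝ → ℝ) (x : BddSeq 𝕜) : ℝ :=
  sInf {l : ℝ | 0 < l ∧ Summable (fun k => M (‖x k‖ / l)) ∧ ∑' k, M (‖x k‖ / l) ≤ 1}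

end

/-! Write `f_k = |T e_k|`. Changing signs and moving the support injectively preserve the norm of a
finitely supported `x`. Averaging over signs and applying Khinchine's inequality therefore gives
`‖x‖_I^p ≈ ∫ (∑ |x k|² f_{j k}²)^(p/2)` for every injective `j`
(`integral_squareFun_bounds_of_injective`).

Now average over all maps `j` from `n` points to `N` points. Non-injective maps have proportion
tending to `0` and integrals bounded independently of `N`, so they do not matter in the limit. For
fixed `t`, the average is a moment of a sum of independent samples from the values `f_i(t)`, `i <
N`. For `0 ≤ r ≤ 1` and independent `X_k ≥ 0`, put `L = ∑ E((1 + X_k)^r - 1)`; then `L / (1 + L) ≤ E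
(∑ X_k)^r ≤ 1 + L` (`expect_sum_rpow_le`, `le_expect_sum_rpow`). With `r = p/2`, `L` is, up to a
bounded factor, the modular of a normalized average of the functions `s ↦ (1 + (s b)²)^(p/2) - 1`,
which lies in `𝓞_{p,2}`. Hence the average is comparable to `w_N(t) ‖x‖^p` in the norm of a random
Orlicz function `M_{N,t}`, with constants depending only on `p` (`sampling_bounds`).

Pushing the normalized weight `w_N` forward along `t ↦ M_{N,t}` gives probability measures on
`𝓞_{p,2}`. This space is compact and metrizable, and `M ↦ ‖x‖_{l_M}^p` is continuous for finitely
supported `x`, so a weak limit along an ultrafilter serves all `x` at once. -/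

open scoped BigOperators
open MeasureTheory Filter Topology

/-! ### Elementary properties of Orlicz functions -/

namespace IsOrlicz

variable {M : ℝ → ℝ}

theorem nonneg (h : IsOrlicz M) (s : ℝ) : 0 ≤ M s := by
  have := h.convex.2 (Set.mem_univ s) (Set.mem_univ (-s))
    (show (0 : ℝ) ≤ 1 / 2 by norm_num) (show (0 : ℝ) ≤ 1 / 2 by norm_num) (by norm_num)
  simp only [smul_eq_mul, h.even] at this
  rw [show (1 / 2 * s + 1 / 2 * -s : ℝ) = 0 by ring, h.zero] at this
  linarith

theorem smul_le (h : IsOrlicz M) {c : ℝ} (h0 : 0 ≤ c) (h1 : c ≤ 1) (s : ℝ) :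
    M (c * s) ≤ c * M s := by
  have := h.convex.2 (Set.mem_univ s) (Set.mem_univ 0)
    h0 (show 0 ≤ 1 - c by linarith) (by ring)
  simpa [h.zero] using this

theorem continuous (h : IsOrlicz M) : Continuous M :=
  continuousOn_univ.1 (h.convex.continuousOn isOpen_univ)

end IsOrlicz

/-! ### Compactness and metrizability of `𝓞_{p,2}` -/

namespace OrliczClass

variable {p : ℝ}

theorem isOrlicz {q : ℝ} (M : OrliczClass p q) : IsOrlicz M := M.2.1

theorem map_one {q : ℝ} (M : OrliczClass p q) : M 1 = 1 := M.2.2.2.2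

/-- Pointwise boundedness is what Tychonoff's theorem needs. Below `1` it comes from convexity,
above `1` from 2-concavity and `M ≥ 0`. -/
theorem apply_le (M : OrliczClass p 2) (s : ℝ) : M s ≤ 2 * s ^ 2 + 1 := by
  wlog hs : 0 ≤ s generalizing s
  · have := this (-s) (by linarith)
    rw [M.isOrlicz.even] at this
    simpa using this
  rcases le_total s 1 with h1 | h1
  · have := M.isOrlicz.smul_le hs h1 1
    rw [mul_one, M.map_one] at this
    nlinarith
  · have hpos : (0 : ℝ) < s ^ 2 - 1 / 2 := by nlinarith
    -- `1` is a convex combination of `s ^ 2` and `1 / 2`. The second endpoint is `1 / 2` because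
    -- concavity is only available on the open half-line.
    have := M.2.2.2.1.2 (show s ^ 2 ∈ Set.Ioi (0 : ℝ) from Set.mem_Ioi.2 (by positivity))
      (show (1 / 2 : ℝ) ∈ Set.Ioi (0 : ℝ) from Set.mem_Ioi.2 (by norm_num))
      (show (0 : ℝ) ≤ (1 / 2) / (s ^ 2 - 1 / 2) by positivity)
      (show (0 : ℝ) ≤ (s ^ 2 - 1) / (s ^ 2 - 1 / 2) from div_nonneg (by nlinarith) hpos.le)
      (by rw [← add_div, div_eq_one_iff_eq hpos.ne']; ring)
    simp only [smul_eq_mul] at this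
    rw [show (1 / 2) / (s ^ 2 - 1 / 2) * s ^ 2 + (s ^ 2 - 1) / (s ^ 2 - 1 / 2) * (1 / 2) = (1 : ℝ) by
      rw [div_mul_eq_mul_div (1 / 2) (s ^ 2 - 1 / 2),
        div_mul_eq_mul_div (s ^ 2 - 1) (s ^ 2 - 1 / 2), ← add_div, div_eq_one_iff_eq hpos.ne']; ring, Real.one_rpow, ← Real.sqrt_eq_rpow, Real.sqrt_sq hs] at this
    have h2 : (M : ℝ → ℝ) 1 = 1 := M.map_one
    have h3 := M.isOrlicz.nonneg ((1 / 2 : ℝ) ^ (1 / 2 : ℝ))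
    have h4 : 0 ≤ (s ^ 2 - 1) / (s ^ 2 - 1 / 2) := div_nonneg (by nlinarith) hpos.le
    have h5 : 1 / 2 / (s ^ 2 - 1 / 2) * (M : ℝ → ℝ) s ≤ 1 := by
      have := mul_nonneg h4 h3
      change 1 / 2 / (s ^ 2 - 1 / 2) * M.1 s ≤ 1
      have h2' : M.1 1 = 1 := h2
      linarith
    rw [div_mul_eq_mul_div, div_le_one hpos] at h5
    linarith

theorem continuous_apply {q : ℝ} (s : ℝ) : Continuous fun M : OrliczClass p q => M s :=
  (_root_.continuous_apply s).comp continuous_induced_dom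

theorem isClosed_setOf :
    IsClosed {M : ℝ → ℝ | IsOrlicz M ∧ OrliczPConvex p M ∧ OrliczQConcave 2 M ∧ M 1 = 1} := by
  have h1 : IsClosed {M : ℝ → ℝ | IsOrlicz M} := by
    have : {M : ℝ → ℝ | IsOrlicz M} =
        {M | ConvexOn ℝ Set.univ M} ∩ ((⋂ t, {M | M (-t) = M t}) ∩ {M | M 0 = 0}) := by
      ext M
      simp only [Set.mem_ofPred_eq, Set.mem_inter_iff, Set.mem_iInter]
      exact ⟨fun h => ⟨h.1, h.2, h.3⟩, fun h => ⟨h.1, h.2.1, h.2.2⟩⟩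
    rw [this]
    refine isClosed_setOfPred_convexOn.inter ((isClosed_iInter fun t => ?_).inter ?_)
    · exact isClosed_eq (by fun_prop) (by fun_prop)
    · exact isClosed_eq (by fun_prop) (by fun_prop)
  refine h1.inter (IsClosed.inter ?_ (IsClosed.inter ?_ ?_))
  · exact isClosed_setOfPred_convexOn.preimage
      (f := fun (M : ℝ → ℝ) (t : ℝ) => M (t ^ (1 / p))) (by fun_prop)
  · exact isClosed_setOfPred_concaveOn.preimage
      (f := fun (M : ℝ → ℝ) (t : ℝ) => M (t ^ (1 / (2 : ℝ)))) (by fun_prop)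
  · exact isClosed_eq (by fun_prop) (by fun_prop)

instance compactSpace : CompactSpace (OrliczClass p 2) := by
  have h : IsCompact {M : ℝ → ℝ | IsOrlicz M ∧ OrliczPConvex p M ∧ OrliczQConcave 2 M ∧
      M 1 = 1} := by
    refine (isCompact_univ_pi fun s : ℝ => isCompact_Icc (a := (0 : ℝ))
      (b := 2 * s ^ 2 + 1)).of_isClosed_subset isClosed_setOf ?_
    intro M hM s _
    exact ⟨hM.1.nonneg s, apply_le ⟨M, hM⟩ s⟩
  exact isCompact_iff_compactSpace.1 h

/-- Restriction of the functions in `𝓞_{p,q}` to the rational numbers. -/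
def toRat {q : ℝ} (M : OrliczClass p q) (s : ℚ) : ℝ := M s

/-- Orlicz functions are continuous, hence determined on `ℚ`; compactness does the rest. The target
is a countable product, which yields metrizability and reduces measurability into `𝓞_{p,2}` to
evaluations. -/
theorem isClosedEmbedding_toRat :
    IsClosedEmbedding (toRat : OrliczClass p 2 → ℚ → ℝ) := by
  refine Continuous.isClosedEmbedding (continuous_pi fun s => continuous_apply _) ?_
  intro M N h
  refine Subtype.ext ?_
  refine M.isOrlicz.continuous.ext_on Rat.isDenseEmbedding_coe_real.dense N.isOrlicz.continuous ?_
  rintro _ ⟨s, rfl⟩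
  exact congr_fun h s

instance metrizableSpace : TopologicalSpace.MetrizableSpace (OrliczClass p 2) :=
  isClosedEmbedding_toRat.isEmbedding.metrizableSpace

theorem measurable_of_apply {α : Type*} [MeasurableSpace α] {F : α → OrliczClass p 2}
    (h : ∀ s : ℝ, Measurable fun t => F t s) : Measurable F := by
  rw [← isClosedEmbedding_toRat.measurableEmbedding.measurable_comp_iff]
  exact measurable_pi_iff.2 fun s => h s

end OrliczClass

/-! ### The Luxemburg norm of finitely supported sequences and its continuity in `M` -/

section OrliczNorm

variable {𝕜 : Type*} [RCLike 𝕜] {M : ℝ → ℝ} {x : BddSeq 𝕜} {n : ℕ}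

/-- The modular `∑ₖ M (|x k| / l)` of a sequence supported in `{0, …, n - 1}`. -/
noncomputable def modular (M : ℝ → ℝ) (x : BddSeq 𝕜) (n : ℕ) (l : ℝ) : ℝ :=
  ∑ k ∈ Finset.range n, M (‖x k‖ / l)

theorem orliczNorm_eq_sInf_modular (h0 : M 0 = 0) (hx : ∀ k, n ≤ k → x k = 0) :
    orliczNorm M x = sInf {l : ℝ | 0 < l ∧ modular M x n l ≤ 1} := by
  have hz : ∀ l, ∀ k ∉ Finset.range n, M (‖x k‖ / l) = 0 := by
    intro l k hk
    rw [hx k (by simpa using hk)]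
    simp [h0]
  unfold orliczNorm modular
  congr 1
  ext l
  simp only [Set.mem_ofPred_eq]
  rw [tsum_eq_sum (hz l)]
  exact ⟨fun h => ⟨h.1, h.2.2⟩, fun h => ⟨h.1, summable_of_ne_finset_zero (hz l), h.2⟩⟩

theorem orliczNorm_nonneg : 0 ≤ orliczNorm M x :=
  Real.sInf_nonneg fun _ h => h.1.le

theorem orliczNorm_le (h0 : M 0 = 0) (hx : ∀ k, n ≤ k → x k = 0) {l : ℝ} (hl : 0 < l)
    (h : modular M x n l ≤ 1) : orliczNorm M x ≤ l := by
  rw [orliczNorm_eq_sInf_modular h0 hx]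
  exact csInf_le ⟨0, fun _ h => h.1.le⟩ ⟨hl, h⟩

theorem one_lt_modular (h0 : M 0 = 0) (hx : ∀ k, n ≤ k → x k = 0) {l : ℝ} (hl : 0 < l)
    (h : l < orliczNorm M x) : 1 < modular M x n l := by
  by_contra! hc
  exact absurd (orliczNorm_le h0 hx hl hc) (not_le.2 h)

theorem modular_nonneg (hM : IsOrlicz M) (l : ℝ) : 0 ≤ modular M x n l :=
  Finset.sum_nonneg fun _ _ => hM.nonneg _

theorem modular_div_le (hM : IsOrlicz M) {l m : ℝ} (hl : 0 < l) (hlm : l ≤ m) :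
    modular M x n m ≤ l / m * modular M x n l := by
  have hm := hl.trans_le hlm
  rw [modular, modular, Finset.mul_sum]
  refine Finset.sum_le_sum fun k _ => ?_
  have := hM.smul_le (div_pos hl hm).le ((div_le_one hm).2 hlm) (‖x k‖ / l)
  rwa [show l / m * (‖x k‖ / l) = ‖x k‖ / m by field_simp] at this

theorem modular_antitone (hM : IsOrlicz M) {l m : ℝ} (hl : 0 < l) (hlm : l ≤ m) :
    modular M x n m ≤ modular M x n l :=
  (modular_div_le hM hl hlm).trans (mul_le_of_le_one_left (modular_nonneg hM l)
    ((div_le_one (hl.trans_le hlm)).2 hlm))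

theorem exists_modular_le_one (hM : IsOrlicz M) : ∃ l, 0 < l ∧ modular M x n l ≤ 1 := by
  refine ⟨modular M x n 1 + 1, by linarith [modular_nonneg (x := x) (n := n) hM 1], ?_⟩
  have h0 := modular_nonneg (x := x) (n := n) hM 1
  refine (modular_div_le hM one_pos (by linarith)).trans ?_
  rw [div_mul_eq_mul_div, one_mul, div_le_one (by linarith)]
  linarith

theorem modular_le_one (hM : IsOrlicz M) (hx : ∀ k, n ≤ k → x k = 0) {l : ℝ}
    (h : orliczNorm M x < l) : modular M x n l ≤ 1 := by
  rw [orliczNorm_eq_sInf_modular hM.zero hx] at h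
  obtain ⟨m, ⟨hm, hm1⟩, hml⟩ := exists_lt_of_csInf_lt (exists_modular_le_one hM) h
  exact (modular_antitone hM hm hml.le).trans hm1

/-- Strictness makes the condition open in `M`, as upper semicontinuity of the norm requires. It
comes from the factor `m / l < 1` supplied by convexity and `M 0 = 0`. -/
theorem modular_lt_one (hM : IsOrlicz M) (hx : ∀ k, n ≤ k → x k = 0) {l : ℝ}
    (h : orliczNorm M x < l) : modular M x n l < 1 := by
  obtain ⟨m, h1, h2⟩ := exists_between h
  have hm : 0 < m := orliczNorm_nonneg.trans_lt h1
  have h3 := modular_le_one hM hx h1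
  have h4 := modular_div_le (x := x) (n := n) hM hm h2.le
  have h5 : m / l < 1 := (div_lt_one (hm.trans h2)).2 h2
  have h6 : 0 < m / l := div_pos hm (hm.trans h2)
  nlinarith

theorem OrliczClass.continuous_modular {p q : ℝ} (x : BddSeq 𝕜) (n : ℕ) (l : ℝ) :
    Continuous fun M : OrliczClass p q => modular M x n l :=
  continuous_finsetSum _ fun _ _ => OrliczClass.continuous_apply _

theorem OrliczClass.continuous_orliczNorm {p q : ℝ} (hx : ∀ k, n ≤ k → x k = 0) :
    Continuous fun M : OrliczClass p q => orliczNorm M x := by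
  rw [continuous_iff_lower_upperSemicontinuous]
  constructor
  · intro M a ha
    rcases lt_or_ge a 0 with h | h
    · exact Eventually.of_forall fun N => h.trans_le orliczNorm_nonneg
    obtain ⟨l, h1, h2⟩ := exists_between ha
    have hl := h.trans_lt h1
    filter_upwards [(continuous_modular x n l).tendsto M |>.eventually
      (lt_mem_nhds (one_lt_modular M.isOrlicz.zero hx hl h2))] with N hN
    refine h1.trans_le ?_
    by_contra! hc
    exact absurd (modular_le_one N.isOrlicz hx hc) (not_le.2 hN)
  · intro M a ha
    obtain ⟨l, h1, h2⟩ := exists_between ha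
    filter_upwards [(continuous_modular x n l).tendsto M |>.eventually
      (gt_mem_nhds (modular_lt_one M.isOrlicz hx h1))] with N hN
    exact (orliczNorm_le N.isOrlicz.zero hx (orliczNorm_nonneg.trans_lt h1) hN.le).trans_lt h2

end OrliczNorm

/-! ### Orlicz functions built from `(1 + (s b)²)^(p/2) - 1` -/

section SamplingOrlicz

/-- This is Minkowski's inequality for the vectors `a (1, u)` and `b (1, v)` in the two-dimensional
`ℓ_q`. -/
theorem convexOn_one_add_rpow_rpow {q : ℝ} (hq : 1 ≤ q) :
    ConvexOn ℝ (Set.Ici 0) fun u : ℝ => (1 + u ^ q) ^ (1 / q) := by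
  have hq0 : 0 < q := by linarith
  refine ⟨convex_Ici 0, fun u hu v hv a b ha hb hab => ?_⟩
  simp only [Set.mem_Ici] at hu hv
  have key : ∀ c w : ℝ, 0 ≤ c → 0 ≤ w →
      (∑ i : Fin 2, ![c, c * w] i ^ q) ^ (1 / q) = c * (1 + w ^ q) ^ (1 / q) := by
    intro c w hc hw
    simp only [Fin.sum_univ_two, Matrix.cons_val_zero, Matrix.cons_val_one]
    rw [Real.mul_rpow hc hw, show c ^ q + c ^ q * w ^ q = c ^ q * (1 + w ^ q) by ring,
      Real.mul_rpow (by positivity) (by positivity), one_div, Real.rpow_rpow_inv hc hq0.ne']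
  have h := Real.Lp_add_le_of_nonneg (s := (Finset.univ : Finset (Fin 2)))
    (f := ![a, a * u]) (g := ![b, b * v]) hq
    (by intro i _; fin_cases i <;> simp <;> positivity)
    (by intro i _; fin_cases i <;> simp <;> positivity)
  have h2 := key 1 (a * u + b * v) zero_le_one (by positivity)
  rw [key a u ha hu, key b v hb hv] at h
  simp only [smul_eq_mul]
  rw [one_mul, one_mul] at h2
  rw [← h2]
  refine le_trans (le_of_eq ?_) h
  congr 1
  simp [Fin.sum_univ_two, hab]

variable {p : ℝ}

/-- The function is `|1 + i s a|^p`: a convex increasing power of the norm of an affine map. -/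
theorem convexOn_one_add_mul_sq_rpow (hp : 1 ≤ p) (a : ℝ) :
    ConvexOn ℝ Set.univ fun s : ℝ => (1 + (s * a) ^ 2) ^ (p / 2) := by
  have key : ∀ s : ℝ, (1 + (s * a) ^ 2) ^ (p / 2) = ‖(⟨1, s * a⟩ : ℂ)‖ ^ p := by
    intro s
    rw [Complex.norm_def, Complex.normSq_mk, Real.sqrt_eq_rpow,
      ← Real.rpow_mul (by nlinarith [sq_nonneg (s * a)])]
    congr 1 <;> ring
  simp only [key]
  refine ⟨convex_univ, fun s _ t _ α β hα hβ hab => ?_⟩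
  refine le_trans (Real.rpow_le_rpow (norm_nonneg _) ?_ (by linarith))
    ((convexOn_rpow hp).2 (norm_nonneg _) (norm_nonneg _) hα hβ hab)
  have : (⟨1, (α • s + β • t) * a⟩ : ℂ) = α • (⟨1, s * a⟩ : ℂ) + β • (⟨1, t * a⟩ : ℂ) := by
    apply Complex.ext
    · simp [hab]
    · simp; ring
  rw [this]
  refine (norm_add_le _ _).trans (le_of_eq ?_)
  rw [norm_smul, norm_smul, Real.norm_of_nonneg hα, Real.norm_of_nonneg hβ]
  rfl

/-- The function is the `ℓ_q` norm of `(1, t a^p)` with `q = 2 / p ≥ 1`. -/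
theorem convexOn_one_add_rpow_mul_sq_rpow (hp : 1 ≤ p) (hp2 : p ≤ 2) {a : ℝ} (ha : 0 ≤ a) :
    ConvexOn ℝ (Set.Ioi 0) fun t : ℝ => (1 + (t ^ (1 / p) * a) ^ 2) ^ (p / 2) := by
  have hp0 : 0 < p := by linarith
  have key : ∀ t : ℝ, 0 < t → (1 + (t ^ (1 / p) * a) ^ 2) ^ (p / 2) =
      (1 + (t * a ^ p) ^ (2 / p)) ^ (1 / (2 / p)) := by
    intro t ht
    rw [one_div_div, Real.mul_rpow ht.le (by positivity), ← Real.rpow_mul ha,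
      mul_div_cancel₀ _ hp0.ne', mul_pow, ← Real.rpow_natCast (t ^ (1 / p)), ← Real.rpow_mul ht.le,
      Real.rpow_two]
    congr 4
    push_cast
    ring
  refine ⟨convex_Ioi 0, fun s hs t ht α β hα hβ hab => ?_⟩
  have hst := (convex_Ioi (0 : ℝ)) hs ht hα hβ hab
  simp only
  rw [key s hs, key t ht, key _ hst]
  have h0 : 0 ≤ a ^ p := by positivity
  have := (convexOn_one_add_rpow_rpow (q := 2 / p) (by rw [le_div_iff₀ hp0]; linarith)).2
    (show s * a ^ p ∈ Set.Ici (0 : ℝ) from mul_nonneg (le_of_lt hs) h0)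
    (show t * a ^ p ∈ Set.Ici (0 : ℝ) from mul_nonneg (le_of_lt ht) h0) hα hβ hab
  convert this using 3
  simp only [smul_eq_mul]
  ring_nf

theorem concaveOn_one_add_sqrt_mul_sq_rpow (hp : 0 ≤ p) (hp2 : p ≤ 2) (a : ℝ) :
    ConcaveOn ℝ (Set.Ioi 0) fun t : ℝ => (1 + (t ^ (1 / (2 : ℝ)) * a) ^ 2) ^ (p / 2) := by
  have key : ∀ t : ℝ, 0 < t → (1 + (t ^ (1 / (2 : ℝ)) * a) ^ 2) ^ (p / 2) =
      (1 + t * a ^ 2) ^ (p / 2) := by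
    intro t ht
    rw [← Real.sqrt_eq_rpow, mul_pow, Real.sq_sqrt ht.le]
  refine ⟨convex_Ioi 0, fun s hs t ht α β hα hβ hab => ?_⟩
  have hst := (convex_Ioi (0 : ℝ)) hs ht hα hβ hab
  simp only
  rw [key s hs, key t ht, key _ hst]
  simp only [Set.mem_Ioi] at hs ht
  have := (Real.concaveOn_rpow (p := p / 2) (by linarith) (by linarith)).2
    (show 1 + s * a ^ 2 ∈ Set.Ici (0 : ℝ) from Set.mem_Ici.2 (by positivity))
    (show 1 + t * a ^ 2 ∈ Set.Ici (0 : ℝ) from Set.mem_Ici.2 (by positivity)) hα hβ hab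
  convert this using 2
  simp only [smul_eq_mul]
  linear_combination -hab

variable {N : ℕ}

/-- The function `s ↦ ∑ᵢ ((1 + (s bᵢ)²)^(p/2) - 1)`. -/
noncomputable def rpowGapSum (p : ℝ) (b : Fin N → ℝ) (s : ℝ) : ℝ :=
  ∑ i, ((1 + (s * b i) ^ 2) ^ (p / 2) - 1)

theorem rpowGapSum_one_pos (hp : 0 < p) {b : Fin N → ℝ} (hb : ∃ i, b i ≠ 0) :
    0 < rpowGapSum p b 1 := by
  refine Finset.sum_pos' (fun i _ => ?_) ?_
  · exact sub_nonneg.2 (Real.one_le_rpow (by nlinarith [sq_nonneg (1 * b i)]) (by linarith))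
  · obtain ⟨i, hi⟩ := hb
    refine ⟨i, Finset.mem_univ i, sub_pos.2 (Real.one_lt_rpow ?_ (by linarith))⟩
    have : 0 < (1 * b i) ^ 2 := by positivity
    linarith

/-- `rpowGapSum`, normalized to take the value `1` at `1`, as an element of `𝓞_{p,2}`. -/
noncomputable def samplingOrlicz (hp : 1 ≤ p) (hp2 : p ≤ 2) (b : Fin N → ℝ) (hb0 : ∀ i, 0 ≤ b i)
    (hb : ∃ i, b i ≠ 0) : OrliczClass p 2 := by
  refine ⟨fun s => (rpowGapSum p b 1)⁻¹ * rpowGapSum p b s, ⟨?_, ?_, ?_⟩, ?_, ?_, ?_⟩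
  all_goals have hpos := rpowGapSum_one_pos (by linarith : 0 < p) hb
  · refine ConvexOn.smul (inv_nonneg.2 hpos.le) ⟨convex_univ, fun s hs t ht α β hα hβ hab => ?_⟩
    simp only [rpowGapSum, smul_eq_mul, Finset.mul_sum, ← Finset.sum_add_distrib]
    refine Finset.sum_le_sum fun i _ => ?_
    have := (convexOn_one_add_mul_sq_rpow hp (b i)).2 hs ht hα hβ hab
    simp only [smul_eq_mul] at this
    linear_combination this + hab
  · intro t
    simp [rpowGapSum]
  · simp [rpowGapSum]
  · refine ConvexOn.smul (inv_nonneg.2 hpos.le) ⟨convex_Ioi 0, fun s hs t ht α β hα hβ hab => ?_⟩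
    simp only [rpowGapSum, smul_eq_mul, Finset.mul_sum, ← Finset.sum_add_distrib]
    refine Finset.sum_le_sum fun i _ => ?_
    have := (convexOn_one_add_rpow_mul_sq_rpow hp hp2 (hb0 i)).2 hs ht hα hβ hab
    simp only [smul_eq_mul] at this
    linear_combination this + hab
  · refine ConcaveOn.smul (inv_nonneg.2 hpos.le) ⟨convex_Ioi 0, fun s hs t ht α β hα hβ hab => ?_⟩
    simp only [rpowGapSum, smul_eq_mul, Finset.mul_sum, ← Finset.sum_add_distrib]
    refine Finset.sum_le_sum fun i _ => ?_
    have := (concaveOn_one_add_sqrt_mul_sq_rpow (by linarith : 0 ≤ p) hp2 (b i)).2 hs ht hα hβ hab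
    simp only [smul_eq_mul] at this
    linear_combination this - hab
  · exact inv_mul_cancel₀ hpos.ne'

theorem rpowGapSum_one_le (hp : 0 ≤ p) (hp2 : p ≤ 2) {b : Fin N → ℝ} (hb0 : ∀ i, 0 ≤ b i)
    (hb : ∑ i, b i ^ p = N) : rpowGapSum p b 1 ≤ N := by
  rw [← hb]
  refine Finset.sum_le_sum fun i _ => ?_
  have := Real.rpow_add_le_add_rpow zero_le_one (sq_nonneg (b i)) (p := p / 2)
    (by linarith) (by linarith)
  rw [Real.one_rpow, ← Real.rpow_natCast, ← Real.rpow_mul (hb0 i)] at this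
  simp only [Nat.cast_ofNat] at this
  rw [show 2 * (p / 2) = p by ring, Real.rpow_two] at this
  rw [one_mul]
  linarith

/-- Concavity of `u ↦ u^(p/2)` at the midpoint of `1` and `b i ^ 2` bounds each term below by an
affine function of `b i ^ p`. Together with `rpowGapSum_one_le`, this keeps the normalizing constant
per sample between two positive numbers independent of `N`. -/
theorem le_rpowGapSum_one (hp : 0 ≤ p) (hp2 : p ≤ 2) {b : Fin N → ℝ} (hb0 : ∀ i, 0 ≤ b i)
    (hb : ∑ i, b i ^ p = N) : ((2 : ℝ) ^ (p / 2) - 1) * N ≤ rpowGapSum p b 1 := by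
  have h : ∀ i, (2 : ℝ) ^ (p / 2) * ((1 + b i ^ p) / 2) - 1 ≤ (1 + (1 * b i) ^ 2) ^ (p / 2) - 1 := by
    intro i
    have h1 := (Real.concaveOn_rpow (p := p / 2) (by linarith) (by linarith)).2
      (show (1 : ℝ) ∈ Set.Ici (0 : ℝ) from Set.mem_Ici.2 zero_le_one)
      (show b i ^ 2 ∈ Set.Ici (0 : ℝ) from Set.mem_Ici.2 (sq_nonneg _))
      (show (0 : ℝ) ≤ 1 / 2 by norm_num) (show (0 : ℝ) ≤ 1 / 2 by norm_num) (by norm_num)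
    simp only [smul_eq_mul] at h1
    have h2 : (b i ^ 2) ^ (p / 2) = b i ^ p := by
      rw [← Real.rpow_natCast, ← Real.rpow_mul (hb0 i)]
      congr 1
      push_cast
      ring
    rw [Real.one_rpow, h2] at h1
    have h3 : (1 + (1 * b i) ^ 2 : ℝ) = 2 * (1 / 2 * 1 + 1 / 2 * b i ^ 2) := by ring
    rw [h3, Real.mul_rpow (by norm_num) (by positivity)]
    have : (0 : ℝ) ≤ 2 ^ (p / 2) := by positivity
    nlinarith
  refine le_trans (le_of_eq ?_) (Finset.sum_le_sum fun i _ => h i)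
  rw [Finset.sum_sub_distrib, ← Finset.mul_sum, ← Finset.sum_div, Finset.sum_add_distrib, hb]
  simp
  ring

end SamplingOrlicz

/-! ### Moments of order at most one of sums of independent variables -/

section IidSums

variable {r : ℝ}

/-- Both `t` and `s + x` are convex combinations of `s` and `t + x`, with interchanged weights;
adding the two concavity inequalities gives the claim. -/
theorem rpow_add_sub_rpow_le (hr : 0 ≤ r) (hr1 : r ≤ 1) {s t x : ℝ} (hs : 0 ≤ s) (hst : s ≤ t)
    (hx : 0 ≤ x) : (t + x) ^ r - t ^ r ≤ (s + x) ^ r - s ^ r := by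
  rcases (show 0 ≤ t + x - s by linarith).eq_or_lt with h | h
  · have h1 : x = 0 := by linarith
    simp [h1]
  have hc := (Real.concaveOn_rpow hr hr1).2 (show s ∈ Set.Ici (0 : ℝ) from hs)
    (show t + x ∈ Set.Ici (0 : ℝ) from Set.mem_Ici.2 (by linarith))
  have hα : 0 ≤ x / (t + x - s) := div_nonneg hx h.le
  have hβ : 0 ≤ (t - s) / (t + x - s) := div_nonneg (by linarith) h.le
  have hαβ : x / (t + x - s) + (t - s) / (t + x - s) = 1 := by
    rw [← add_div, div_eq_one_iff_eq h.ne']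
    ring
  have h1 := hc hα hβ hαβ
  have h2 := hc hβ hα (by rw [add_comm]; exact hαβ)
  have hD := div_mul_cancel₀ x h.ne'
  simp only [smul_eq_mul] at h1 h2
  set α := x / (t + x - s) with hαdef
  set β := (t - s) / (t + x - s) with hβdef
  have e0 : β = 1 - α := by linarith
  rw [show α * s + β * (t + x) = t by rw [e0]; linear_combination -hD] at h1
  rw [show β * s + α * (t + x) = s + x by rw [e0]; linear_combination hD] at h2
  rw [e0] at h1 h2
  linarith

/-- For `s ≤ 1` the increment at `s` dominates the one at `1`; for `s ≥ 1` the factor `1 - s ^ r` is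
nonpositive and monotonicity suffices. The bound is affine in `s ^ r`, so it can be averaged over
independent variables. -/
theorem rpow_add_gap_le (hr : 0 ≤ r) (hr1 : r ≤ 1) {s x : ℝ} (hs : 0 ≤ s) (hx : 0 ≤ x) :
    s ^ r + (1 - s ^ r) * ((1 + x) ^ r - 1) ≤ (s + x) ^ r := by
  have hg : 0 ≤ (1 + x) ^ r - 1 := sub_nonneg.2 (Real.one_le_rpow (by linarith) hr)
  have hs0 : 0 ≤ s ^ r := Real.rpow_nonneg hs r
  rcases le_total s 1 with h | h
  · have := rpow_add_sub_rpow_le hr hr1 hs h hx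
    rw [Real.one_rpow] at this
    nlinarith
  · have h1 : 1 ≤ s ^ r := Real.one_le_rpow h hr
    have h2 : s ^ r ≤ (s + x) ^ r := Real.rpow_le_rpow hs (by linarith) hr
    nlinarith

theorem expect_fin_succ {α : Type*} [Fintype α] {n : ℕ} (F : (Fin (n + 1) → α) → ℝ) :
    𝔼 j, F j = 𝔼 i, 𝔼 j : Fin n → α, F (Fin.cons i j) := by
  rw [← Fintype.expect_equiv (Fin.consEquiv fun _ => α) (fun q => F (Fin.cons q.1 q.2)) F
    (fun _ => rfl), ← Finset.univ_product_univ, Finset.expect_product]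

variable {N : ℕ} [NeZero N] {b : Fin N → ℝ}

/-- Peel off one variable at a time: by concavity, adding it to `1 + S` raises the `r`-th power no
more than adding it to `1`. -/
theorem expect_one_add_sum_rpow_le (hr : 0 ≤ r) (hr1 : r ≤ 1) (hb : ∀ i, 0 ≤ b i) :
    ∀ {n : ℕ} {a : Fin n → ℝ}, (∀ k, 0 ≤ a k) →
      𝔼 j : Fin n → Fin N, (1 + ∑ k, a k * b (j k)) ^ r ≤
        1 + ∑ k, 𝔼 i, ((1 + a k * b i) ^ r - 1)
  | 0, a, _ => by simp
  | n + 1, a, ha => by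
    rw [expect_fin_succ, Fin.sum_univ_succ]
    have ih := expect_one_add_sum_rpow_le hr hr1 hb (a := fun k => a k.succ) fun k => ha _
    have : ∀ i : Fin N, 𝔼 j : Fin n → Fin N,
        (1 + ∑ k, a k * b ((Fin.cons i j : Fin (n + 1) → Fin N) k)) ^ r ≤
          (1 + ∑ k : Fin n, 𝔼 i, ((1 + a k.succ * b i) ^ r - 1)) + ((1 + a 0 * b i) ^ r - 1) := by
      intro i
      refine le_trans ?_ (add_le_add_left ih _)
      rw [← Fintype.expect_const (ι := Fin n → Fin N) ((1 + a 0 * b i) ^ r - 1),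
        ← Finset.expect_add_distrib]
      refine Finset.expect_le_expect fun j _ => ?_
      have hS : 0 ≤ ∑ k : Fin n, a k.succ * b (j k) :=
        Finset.sum_nonneg fun k _ => mul_nonneg (ha _) (hb _)
      have := rpow_add_sub_rpow_le hr hr1 zero_le_one
        (show 1 ≤ 1 + ∑ k : Fin n, a k.succ * b (j k) by linarith) (mul_nonneg (ha 0) (hb i))
      rw [Real.one_rpow] at this
      simp only [Fin.sum_univ_succ, Fin.cons_zero, Fin.cons_succ]
      rw [show 1 + (a 0 * b i + ∑ k : Fin n, a k.succ * b (j k)) =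
        1 + ∑ k : Fin n, a k.succ * b (j k) + a 0 * b i by ring]
      linarith
    refine (Finset.expect_le_expect fun i _ => this i).trans (le_of_eq ?_)
    rw [Finset.expect_add_distrib, Fintype.expect_const]
    ring

theorem expect_sum_rpow_le (hr : 0 ≤ r) (hr1 : r ≤ 1) (hb : ∀ i, 0 ≤ b i) {n : ℕ}
    {a : Fin n → ℝ} (ha : ∀ k, 0 ≤ a k) :
    𝔼 j : Fin n → Fin N, (∑ k, a k * b (j k)) ^ r ≤
      1 + ∑ k, 𝔼 i, ((1 + a k * b i) ^ r - 1) :=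
  (Finset.expect_le_expect fun j _ => Real.rpow_le_rpow
    (Finset.sum_nonneg fun k _ => mul_nonneg (ha _) (hb _)) (by linarith) hr).trans
    (expect_one_add_sum_rpow_le hr hr1 hb ha)

/-- Let `D'` be the new moment, `D` the old one, `L` the old sum of gaps and `l` the new gap. Then
`D' ≥ D` and `D' ≥ D + (1 - D) l`, so `(1 - D') (l + L) ≤ (1 - D) l + (1 - D) L ≤ (1 - D) l + D ≤
D'`. -/
theorem le_expect_sum_rpow (hr : 0 ≤ r) (hr1 : r ≤ 1) (hb : ∀ i, 0 ≤ b i) :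
    ∀ {n : ℕ} {a : Fin n → ℝ}, (∀ k, 0 ≤ a k) →
      (1 - 𝔼 j : Fin n → Fin N, (∑ k, a k * b (j k)) ^ r) *
        (∑ k, 𝔼 i, ((1 + a k * b i) ^ r - 1)) ≤ 𝔼 j : Fin n → Fin N, (∑ k, a k * b (j k)) ^ r
  | 0, a, _ => by
    simp only [Finset.univ_eq_empty, Finset.sum_empty, mul_zero]
    exact Finset.expect_nonneg fun j _ => Real.rpow_nonneg le_rfl _
  | n + 1, a, ha => by
    have ih := le_expect_sum_rpow hr hr1 hb (a := fun k => a k.succ) fun k => ha _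
    set D := 𝔼 j : Fin n → Fin N, (∑ k : Fin n, a k.succ * b (j k)) ^ r with hD
    have hS : ∀ j : Fin n → Fin N, 0 ≤ ∑ k : Fin n, a k.succ * b (j k) := fun j =>
      Finset.sum_nonneg fun k _ => mul_nonneg (ha _) (hb _)
    have hg : ∀ k i, 0 ≤ (1 + a k * b i) ^ r - 1 := fun k i =>
      sub_nonneg.2 (Real.one_le_rpow (by nlinarith [mul_nonneg (ha k) (hb i)]) hr)
    have hL : 0 ≤ ∑ k : Fin n, 𝔼 i, ((1 + a k.succ * b i) ^ r - 1) :=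
      Finset.sum_nonneg fun k _ => Finset.expect_nonneg fun i _ => hg _ i
    have hl : 0 ≤ 𝔼 i, ((1 + a 0 * b i) ^ r - 1) := Finset.expect_nonneg fun i _ => hg _ i
    have e : 𝔼 j : Fin (n + 1) → Fin N, (∑ k, a k * b (j k)) ^ r =
        𝔼 i, 𝔼 j : Fin n → Fin N, (∑ k : Fin n, a k.succ * b (j k) + a 0 * b i) ^ r := by
      rw [expect_fin_succ]
      simp only [Fin.sum_univ_succ, Fin.cons_zero, Fin.cons_succ, add_comm (a 0 * b _)]
    have h1 : D ≤ 𝔼 j : Fin (n + 1) → Fin N, (∑ k, a k * b (j k)) ^ r := by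
      rw [e, ← Fintype.expect_const (ι := Fin N) D]
      refine Finset.expect_le_expect fun i _ => Finset.expect_le_expect fun j _ => ?_
      exact Real.rpow_le_rpow (hS j) (by linarith [mul_nonneg (ha 0) (hb i)]) hr
    have h2 : D + (1 - D) * 𝔼 i, ((1 + a 0 * b i) ^ r - 1) ≤
        𝔼 j : Fin (n + 1) → Fin N, (∑ k, a k * b (j k)) ^ r := by
      have h3 : ∀ i, D + (1 - D) * ((1 + a 0 * b i) ^ r - 1) ≤
          𝔼 j : Fin n → Fin N, (∑ k : Fin n, a k.succ * b (j k) + a 0 * b i) ^ r := by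
        intro i
        refine le_trans (le_of_eq ?_) (Finset.expect_le_expect fun j _ =>
          rpow_add_gap_le hr hr1 (hS j) (mul_nonneg (ha 0) (hb i)))
        rw [Finset.expect_add_distrib, ← Finset.expect_mul, Finset.expect_sub_distrib,
          Fintype.expect_const]
      rw [e]
      refine le_trans (le_of_eq ?_) (Finset.expect_le_expect fun i _ => h3 i)
      rw [Finset.expect_add_distrib, ← Finset.mul_expect, Fintype.expect_const]
    rw [Fin.sum_univ_succ]
    nlinarith

end IidSums

/-! ### Comparison of sampling averages with Orlicz norms -/

section Sampling

variable {𝕜 : Type*} [RCLike 𝕜] {p : ℝ} {N : ℕ} {a : Fin N → ℝ} {n : ℕ}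

/-- The average of `(∑ₖ |x k|² a(j k)²)^(p/2)` over all `j : {0, …, n - 1} → {0, …, N - 1}`. -/
noncomputable def samplingAverage (p : ℝ) (a : Fin N → ℝ) (x : BddSeq 𝕜) (n : ℕ) : ℝ :=
  𝔼 j : Fin n → Fin N, (∑ k : Fin n, ‖x k‖ ^ 2 * a (j k) ^ 2) ^ (p / 2)

theorem samplingAverage_nonneg (x : BddSeq 𝕜) : 0 ≤ samplingAverage p a x n :=
  Finset.expect_nonneg fun _ _ => by positivity

theorem samplingAverage_eq_mul {l W : ℝ} (hl : 0 < l) (hW : 0 < W)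
    (x : BddSeq 𝕜) :
    samplingAverage p a x n = (l * W) ^ p * 𝔼 j : Fin n → Fin N,
      (∑ k : Fin n, (‖x k‖ / l) ^ 2 * (a (j k) / W) ^ 2) ^ (p / 2) := by
  rw [samplingAverage, Finset.mul_expect]
  refine Finset.expect_congr rfl fun j _ => ?_
  have h : (l * W) ^ p = ((l * W) ^ 2) ^ (p / 2) := by
    rw [← Real.rpow_natCast, ← Real.rpow_mul (by positivity)]
    congr 1
    push_cast
    ring
  rw [h, ← Real.mul_rpow (by positivity) (by positivity), Finset.mul_sum]
  congr 1
  refine Finset.sum_congr rfl fun k _ => ?_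
  field_simp

theorem sum_expect_gap_eq (hp : 1 ≤ p) (hp2 : p ≤ 2) {b : Fin N → ℝ} (hb0 : ∀ i, 0 ≤ b i)
    (hb : ∃ i, b i ≠ 0) (x : BddSeq 𝕜) (l : ℝ) :
    ∑ k : Fin n, 𝔼 i, ((1 + (‖x k‖ / l) ^ 2 * b i ^ 2) ^ (p / 2) - 1) =
      rpowGapSum p b 1 / N * modular (samplingOrlicz hp hp2 b hb0 hb) x n l := by
  have hpos := rpowGapSum_one_pos (by linarith : 0 < p) hb
  rw [modular, Finset.sum_range, Finset.mul_sum]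
  refine Finset.sum_congr rfl fun k _ => ?_
  change _ = _ * ((rpowGapSum p b 1)⁻¹ * rpowGapSum p b (‖x k‖ / l))
  rw [Fintype.expect_eq_sum_div_card, Fintype.card_fin, div_mul_eq_mul_div,
    mul_inv_cancel_left₀ hpos.ne', rpowGapSum]
  simp only [mul_pow]

theorem exists_div_ne_zero (hp : 1 ≤ p) (h : 0 < 𝔼 i, a i ^ p) :
    ∃ i, a i / (𝔼 i, a i ^ p) ^ (1 / p) ≠ 0 := by
  by_contra! hc
  have hW : 0 < (𝔼 i, a i ^ p) ^ (1 / p) := Real.rpow_pos_of_pos h _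
  have h0 : ∀ i, a i = 0 := fun i => by
    have := hc i
    rwa [div_eq_zero_iff, or_iff_left hW.ne'] at this
  simp [h0, Real.zero_rpow (by linarith : p ≠ 0)] at h

/-- The Orlicz function of the sample `a`. -/
noncomputable def sampleOrlicz (hp : 1 ≤ p) (hp2 : p ≤ 2) (a : Fin N → ℝ) : OrliczClass p 2 :=
  if h : (∀ i, 0 ≤ a i) ∧ 0 < 𝔼 i, a i ^ p then
    samplingOrlicz hp hp2 (fun i => a i / (𝔼 i, a i ^ p) ^ (1 / p))
      (fun i => div_nonneg (h.1 i) (Real.rpow_nonneg h.2.le _)) (exists_div_ne_zero hp h.2)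
  -- An arbitrary default: when the weight vanishes, both sides of the comparison are zero.
  else samplingOrlicz hp hp2 (fun _ : Fin 1 => 1) (fun _ => zero_le_one) ⟨0, one_ne_zero⟩

theorem samplingAverage_eq_zero (hp : 1 ≤ p) (ha : ∀ i, 0 ≤ a i) (h : 𝔼 i, a i ^ p = 0)
    (x : BddSeq 𝕜) : samplingAverage p a x n = 0 := by
  have hp0 : p ≠ 0 := by linarith
  have h0 : ∀ i, a i = 0 := by
    intro i
    have := (Finset.expect_eq_zero_iff_of_nonneg
      fun i _ => Real.rpow_nonneg (ha i) p).1 h i (Finset.mem_univ i)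
    exact (Real.rpow_eq_zero (ha i) hp0).1 this
  simp [samplingAverage, h0, Real.zero_rpow (by simpa using hp0 : p / 2 ≠ 0)]

/-- After scaling by `l * W`, the gap sum is the modular at `l` times a factor in `[c, 1]`. The
modular is at most `1` for `l` above the Orlicz norm and exceeds `1` below it; letting `l` tend to
the norm gives the two bounds. -/
theorem samplingOrlicz_bounds [NeZero N] (hp : 1 ≤ p) (hp2 : p ≤ 2) (ha : ∀ i, 0 ≤ a i) {W : ℝ}
    (hW : 0 < W) (hWp : W ^ p = 𝔼 i, a i ^ p) (hb0 : ∀ i, 0 ≤ a i / W) (hb : ∃ i, a i / W ≠ 0)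
    {x : BddSeq 𝕜} (hx : ∀ k, n ≤ k → x k = 0) :
    samplingAverage p a x n ≤
        2 * (W ^ p * orliczNorm (samplingOrlicz hp hp2 (fun i => a i / W) hb0 hb) x ^ p) ∧
      (2 ^ (p / 2) - 1) / 2 *
          (W ^ p * orliczNorm (samplingOrlicz hp hp2 (fun i => a i / W) hb0 hb) x ^ p) ≤
        samplingAverage p a x n := by
  have hp0 : 0 < p := by linarith
  set b : Fin N → ℝ := fun i => a i / W with hbdef
  set M := samplingOrlicz hp hp2 b hb0 hb
  have hN : (0 : ℝ) < N := Nat.cast_pos.2 (NeZero.pos N)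
  have hbN : ∑ i, b i ^ p = N := by
    have : ∀ i, b i ^ p = a i ^ p / W ^ p := fun i => Real.div_rpow (ha i) hW.le p
    have h0 : 0 < W ^ p := Real.rpow_pos_of_pos hW p
    rw [Finset.sum_congr rfl fun i _ => this i, ← Finset.sum_div, div_eq_iff h0.ne', hWp,
      Fintype.expect_eq_sum_div_card, Fintype.card_fin, mul_div_cancel₀ _ hN.ne']
  set c : ℝ := 2 ^ (p / 2) - 1 with hc
  have hc0 : 0 < c := sub_pos.2 (Real.one_lt_rpow one_lt_two (by linarith))
  have hm1 : rpowGapSum p b 1 / N ≤ 1 := by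
    rw [div_le_one hN]
    exact rpowGapSum_one_le hp0.le hp2 hb0 hbN
  have hmc : c ≤ rpowGapSum p b 1 / N := by
    rw [le_div_iff₀ hN]
    exact le_rpowGapSum_one hp0.le hp2 hb0 hbN
  have hup := fun l : ℝ => expect_sum_rpow_le (r := p / 2) (by linarith) (by linarith)
    (fun i : Fin N => sq_nonneg (b i)) (n := n) (a := fun k => (‖x k‖ / l) ^ 2) fun k => sq_nonneg _
  have hlow := fun l : ℝ => le_expect_sum_rpow (r := p / 2) (by linarith) (by linarith)
    (fun i : Fin N => sq_nonneg (b i)) (n := n) (a := fun k => (‖x k‖ / l) ^ 2) fun k => sq_nonneg _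
  simp only [sum_expect_gap_eq hp hp2 (b := b) hb0 hb] at hup hlow
  have heq := fun (l : ℝ) (hl : 0 < l) => samplingAverage_eq_mul (p := p) (n := n) (a := a) hl hW x
  set R := orliczNorm M.1 x
  have hR : 0 ≤ R := orliczNorm_nonneg
  have hcont : Continuous fun l : ℝ => W ^ p * l ^ p :=
    continuous_const.mul (Real.continuous_rpow_const hp0.le)
  constructor
  · refine ge_of_tendsto (f := fun l => 2 * (W ^ p * l ^ p)) (x := 𝓝[>] R)
      (((continuous_const.mul hcont).tendsto R).mono_left nhdsWithin_le_nhds) ?_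
    filter_upwards [self_mem_nhdsWithin] with l hl
    have hl0 : 0 < l := hR.trans_lt hl
    have hmod : modular M.1 x n l ≤ 1 := modular_le_one M.isOrlicz hx hl
    have hmod0 : 0 ≤ modular M.1 x n l := modular_nonneg M.isOrlicz l
    rw [heq l hl0, Real.mul_rpow hl0.le hW.le]
    have h1 : 0 ≤ l ^ p * W ^ p := by positivity
    have := mul_le_mul_of_nonneg_left ((hup l).trans
      (show 1 + rpowGapSum p b 1 / N * modular M.1 x n l ≤ 2 by nlinarith)) h1
    linarith
  · rcases hR.eq_or_lt with h | h
    · rw [← h, Real.zero_rpow hp0.ne', mul_zero, mul_zero]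
      exact samplingAverage_nonneg x
    refine le_of_tendsto (f := fun l => c / 2 * (W ^ p * l ^ p)) (x := 𝓝[<] R)
      (((continuous_const.mul hcont).tendsto R).mono_left nhdsWithin_le_nhds) ?_
    filter_upwards [Ioo_mem_nhdsLT h] with l hl
    have hmod : 1 < modular M.1 x n l := one_lt_modular M.isOrlicz.zero hx hl.1 hl.2
    rw [heq l hl.1, Real.mul_rpow hl.1.le hW.le]
    have h1 : 0 ≤ l ^ p * W ^ p := mul_nonneg (Real.rpow_nonneg hl.1.le _) (by positivity)
    have hl2 := hlow l
    have hc1 : c ≤ 1 := hmc.trans hm1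
    set d := 𝔼 j : Fin n → Fin N, (∑ k : Fin n, (‖x k‖ / l) ^ 2 * b (j k) ^ 2) ^ (p / 2)
    -- If `d < c / 2 ≤ 1 / 2`, then `(1 - d) * c > c / 2 > d`, contradicting the lower moment bound.
    have hd : c / 2 ≤ d := by
      by_contra! hcon
      have h3 : c < rpowGapSum p b 1 / N * modular M.1 x n l := by nlinarith
      have h4 : (1 - d) * c ≤ d := le_trans (by nlinarith) hl2
      nlinarith
    have := mul_le_mul_of_nonneg_left hd h1
    linarith

theorem sampling_bounds [NeZero N] (hp : 1 ≤ p) (hp2 : p ≤ 2) (ha : ∀ i, 0 ≤ a i) {x : BddSeq 𝕜}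
    (hx : ∀ k, n ≤ k → x k = 0) :
    samplingAverage p a x n ≤
        2 * ((𝔼 i, a i ^ p) * orliczNorm (sampleOrlicz hp hp2 a) x ^ p) ∧
      (2 ^ (p / 2) - 1) / 2 * ((𝔼 i, a i ^ p) * orliczNorm (sampleOrlicz hp hp2 a) x ^ p) ≤
        samplingAverage p a x n := by
  have hp0 : 0 < p := by linarith
  have hw : 0 ≤ 𝔼 i, a i ^ p := Finset.expect_nonneg fun i _ => Real.rpow_nonneg (ha i) _
  rcases hw.eq_or_lt with h0 | h0
  · rw [samplingAverage_eq_zero hp ha h0.symm, ← h0]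
    simp
  have hWp : ((𝔼 i, a i ^ p) ^ (1 / p)) ^ p = 𝔼 i, a i ^ p := by
    rw [one_div, Real.rpow_inv_rpow h0.le hp0.ne']
  have := samplingOrlicz_bounds hp hp2 ha (Real.rpow_pos_of_pos h0 (1 / p)) hWp
    (fun i => div_nonneg (ha i) (Real.rpow_nonneg h0.le _))
    (exists_div_ne_zero hp h0) hx
  rw [hWp] at this
  rw [sampleOrlicz, dif_pos ⟨ha, h0⟩]
  exact this

end Sampling

/-! ### Khinchine's inequality for real or complex scalars -/

section Khinchine

variable {𝕜 : Type*} [RCLike 𝕜] {n : ℕ}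

/-- The sign `±1` attached to a Boolean. -/
def boolSign (𝕜 : Type*) [RCLike 𝕜] (b : Bool) : 𝕜 := if b then 1 else -1

theorem norm_boolSign (b : Bool) : ‖boolSign 𝕜 b‖ = 1 := by
  cases b <;> simp [boolSign]

theorem expect_bool (F : Bool → ℝ) : 𝔼 b, F b = (F true + F false) / 2 := by
  rw [Fintype.expect_eq_sum_div_card, Fintype.sum_bool]
  simp

theorem norm_add_sq_add_norm_sub_sq (z w : 𝕜) :
    ‖z + w‖ ^ 2 + ‖z - w‖ ^ 2 = 2 * (‖z‖ ^ 2 + ‖w‖ ^ 2) := by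
  exact parallelogram_law_with_norm 𝕜 z w

/-- With `A`, `B` the two squared norms, `A² + B² = ((A + B)² + (A - B)²) / 2`; the parallelogram
law gives `A + B`, and the triangle inequality bounds `A - B`. -/
theorem norm_add_pow_four_add_le (z w : 𝕜) :
    ‖z + w‖ ^ 4 + ‖z - w‖ ^ 4 ≤ 2 * (‖z‖ ^ 4 + 6 * (‖z‖ ^ 2 * ‖w‖ ^ 2) + ‖w‖ ^ 4) := by
  have h := norm_add_sq_add_norm_sub_sq z w
  have h1 : ‖z + w‖ ≤ ‖z‖ + ‖w‖ := norm_add_le z w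
  have h2 : ‖z - w‖ ≤ ‖z‖ + ‖w‖ := norm_sub_le z w
  have h3 : |‖z + w‖ ^ 2 - ‖z - w‖ ^ 2| ≤ 4 * (‖z‖ * ‖w‖) := by
    have h1' : ‖z + w‖ ^ 2 ≤ (‖z‖ + ‖w‖) ^ 2 := by gcongr
    have h2' : ‖z - w‖ ^ 2 ≤ (‖z‖ + ‖w‖) ^ 2 := by gcongr
    rw [abs_le]
    constructor <;> nlinarith
  have h4 := sq_le_sq' (by linarith [abs_le.1 h3]) (abs_le.1 h3).2
  nlinarith

/-- The Rademacher sum with signs `σ`. -/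
def signSum (c : Fin n → 𝕜) (σ : Fin n → Bool) : 𝕜 := ∑ k, boolSign 𝕜 (σ k) * c k

theorem signSum_cons (c : Fin (n + 1) → 𝕜) (b : Bool) (σ : Fin n → Bool) :
    signSum c (Fin.cons b σ) = signSum (fun k => c k.succ) σ + boolSign 𝕜 b * c 0 := by
  simp [signSum, Fin.sum_univ_succ, add_comm]

theorem expect_norm_signSum_sq : ∀ {n : ℕ} (c : Fin n → 𝕜),
    𝔼 σ, ‖signSum c σ‖ ^ 2 = ∑ k, ‖c k‖ ^ 2
  | 0, c => by simp [signSum]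
  | n + 1, c => by
    rw [expect_fin_succ, expect_bool, Fin.sum_univ_succ,
      ← expect_norm_signSum_sq fun k => c k.succ, ← Finset.expect_add_distrib, Finset.expect_div,
      ← Fintype.expect_const (ι := Fin n → Bool) (‖c 0‖ ^ 2), ← Finset.expect_add_distrib]
    refine Finset.expect_congr rfl fun σ _ => ?_
    have := norm_add_sq_add_norm_sub_sq (signSum (fun k => c k.succ) σ) (c 0)
    simp only [signSum_cons, boolSign, if_true, Bool.false_eq_true, if_false, one_mul, neg_mul,
      ← sub_eq_add_neg]
    linarith

theorem expect_norm_signSum_pow_four_le : ∀ {n : ℕ} (c : Fin n → 𝕜),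
    𝔼 σ, ‖signSum c σ‖ ^ 4 ≤ 3 * (∑ k, ‖c k‖ ^ 2) ^ 2
  | 0, c => by simp [signSum]
  | n + 1, c => by
    have ih := expect_norm_signSum_pow_four_le fun k => c k.succ
    have h2 := expect_norm_signSum_sq fun k => c k.succ
    rw [expect_fin_succ, expect_bool, Fin.sum_univ_succ, ← Finset.expect_add_distrib,
      Finset.expect_div]
    have : 𝔼 σ : Fin n → Bool, (‖signSum c (Fin.cons true σ)‖ ^ 4 +
        ‖signSum c (Fin.cons false σ)‖ ^ 4) / 2 ≤
        𝔼 σ : Fin n → Bool, (‖signSum (fun k => c k.succ) σ‖ ^ 4 +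
          ‖signSum (fun k => c k.succ) σ‖ ^ 2 * (6 * ‖c 0‖ ^ 2) + ‖c 0‖ ^ 4) := by
      refine Finset.expect_le_expect fun σ _ => ?_
      have := norm_add_pow_four_add_le (signSum (fun k => c k.succ) σ) (c 0)
      simp only [signSum_cons, boolSign, if_true, Bool.false_eq_true, if_false, one_mul, neg_mul,
        ← sub_eq_add_neg]
      linarith
    refine this.trans ?_
    rw [Finset.expect_add_distrib, Finset.expect_add_distrib, ← Finset.expect_mul, h2,
      Fintype.expect_const]
    nlinarith [sq_nonneg (‖c 0‖ ^ 2)]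

variable {p : ℝ}

theorem rpow_le_one_add_sq (hp : 0 ≤ p) (hp2 : p ≤ 2) {y : ℝ} (hy : 0 ≤ y) : y ^ p ≤ 1 + y ^ 2 := by
  rcases le_total y 1 with h | h
  · linarith [Real.rpow_le_one hy h hp, sq_nonneg y]
  · have := Real.rpow_le_rpow_of_exponent_le h hp2
    rw [Real.rpow_two] at this
    linarith

theorem sq_sub_pow_four_le_rpow (hp : 0 ≤ p) (hp2 : p ≤ 2) {y : ℝ} (hy : 0 ≤ y) :
    y ^ 2 - y ^ 4 / 4 ≤ y ^ p := by
  rcases hy.eq_or_lt with rfl | h0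
  · simpa using Real.rpow_nonneg le_rfl p
  rcases le_total y 1 with h | h
  · have := Real.rpow_le_rpow_of_exponent_ge h0 h hp2
    rw [Real.rpow_two] at this
    linarith [pow_nonneg hy 4]
  · nlinarith [Real.one_le_rpow h hp, sq_nonneg (y ^ 2 - 2)]

/-- Normalize the second moment to `1`; the fourth is then at most `3`. Integrating `y² - y⁴ / 4 ≤
y^p ≤ 1 + y²` gives the constants `1 - 3 / 4` and `2`. -/
theorem khinchine (hp : 0 < p) (hp2 : p ≤ 2) (c : Fin n → 𝕜) :
    𝔼 σ, ‖signSum c σ‖ ^ p ≤ 2 * (∑ k, ‖c k‖ ^ 2) ^ (p / 2) ∧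
      1 / 4 * (∑ k, ‖c k‖ ^ 2) ^ (p / 2) ≤ 𝔼 σ, ‖signSum c σ‖ ^ p := by
  have hS : 0 ≤ ∑ k, ‖c k‖ ^ 2 := Finset.sum_nonneg fun k _ => sq_nonneg _
  rcases hS.eq_or_lt with h0 | h0
  · have hc : ∀ k, c k = 0 := fun k => by
      have := (Finset.sum_eq_zero_iff_of_nonneg fun k _ => sq_nonneg _).1 h0.symm k
        (Finset.mem_univ k)
      simpa using this
    simp [signSum, hc, Real.zero_rpow hp.ne', Real.zero_rpow (by linarith : p / 2 ≠ 0)]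
  set S := ∑ k, ‖c k‖ ^ 2 with hSdef
  set s := √S with hs
  have hs0 : 0 < s := Real.sqrt_pos.2 h0
  have hsS : s ^ 2 = S := Real.sq_sqrt hS
  have hsp : S ^ (p / 2) = s ^ p := by
    rw [hs, Real.sqrt_eq_rpow, ← Real.rpow_mul hS]
    congr 1
    ring
  have e2 : 𝔼 σ, (‖signSum c σ‖ / s) ^ 2 = 1 := by
    simp only [div_pow]
    rw [← Finset.expect_div, expect_norm_signSum_sq, hsS, div_self h0.ne']
  have e4 : 𝔼 σ, (‖signSum c σ‖ / s) ^ 4 ≤ 3 := by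
    simp only [div_pow]
    rw [← Finset.expect_div, div_le_iff₀ (by positivity)]
    refine (expect_norm_signSum_pow_four_le c).trans (le_of_eq ?_)
    rw [← hSdef, ← hsS]
    ring
  have ep : 𝔼 σ, ‖signSum c σ‖ ^ p = s ^ p * 𝔼 σ, (‖signSum c σ‖ / s) ^ p := by
    rw [Finset.mul_expect]
    refine Finset.expect_congr rfl fun σ _ => ?_
    rw [← Real.mul_rpow hs0.le (by positivity), mul_div_cancel₀ _ hs0.ne']
  have hsp0 : 0 ≤ s ^ p := by positivity
  rw [ep, hsp]
  constructor
  · have : 𝔼 σ, (‖signSum c σ‖ / s) ^ p ≤ 𝔼 σ, (1 + (‖signSum c σ‖ / s) ^ 2) :=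
      Finset.expect_le_expect fun σ _ => rpow_le_one_add_sq hp.le hp2 (by positivity)
    rw [Finset.expect_add_distrib, e2, Fintype.expect_const] at this
    nlinarith
  · have : 𝔼 σ, ((‖signSum c σ‖ / s) ^ 2 - (‖signSum c σ‖ / s) ^ 4 / 4) ≤
        𝔼 σ, (‖signSum c σ‖ / s) ^ p :=
      Finset.expect_le_expect fun σ _ => sq_sub_pow_four_le_rpow hp.le hp2 (by positivity)
    rw [Finset.expect_sub_distrib, e2, ← Finset.expect_div] at this
    nlinarith

end Khinchine

/-! ### Finitely supported elements of a symmetric sequence space -/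

section Sequences

variable {𝕜 : Type*} [RCLike 𝕜] {n : ℕ}

theorem exists_card_le_of_norm_eq {x y : BddSeq 𝕜} {i j : Fin n → ℕ} (hi : i.Injective)
    (h : ∀ k, ‖y (j k)‖ = ‖x (i k)‖) (hy : ∀ m ∉ Set.range j, y m = 0) {m : ℕ} {s : ℝ}
    (hs : ∃ A : Finset ℕ, A.card ≤ m ∧ ∀ l ∉ A, ‖x l‖ ≤ s) :
    ∃ A : Finset ℕ, A.card ≤ m ∧ ∀ l ∉ A, ‖y l‖ ≤ s := by
  classical
  obtain ⟨A, hA, hAs⟩ := hs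
  -- Some index lies outside the finite set `A`, which forces `s ≥ 0`; this covers the zero entries
  -- of `y`.
  have hs0 : 0 ≤ s := by
    obtain ⟨l, hl⟩ := Infinite.exists_notMem_finset A
    exact (norm_nonneg _).trans (hAs l hl)
  refine ⟨(Finset.univ.filter fun k => i k ∈ A).image j, ?_, fun l hl => ?_⟩
  · refine Finset.card_image_le.trans (le_trans ?_ hA)
    exact Finset.card_le_card_of_injOn i (fun k hk => by simpa using hk) hi.injOn
  · by_cases hr : l ∈ Set.range j
    · obtain ⟨k, rfl⟩ := hr
      rw [h]
      refine hAs _ fun hk => hl ?_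
      exact Finset.mem_image_of_mem j (by simpa using hk)
    · rw [hy l hr, norm_zero]
      exact hs0

theorem decRearr_eq_of_norm_eq {x y : BddSeq 𝕜} {i j : Fin n → ℕ} (hi : i.Injective)
    (hj : j.Injective) (h : ∀ k, ‖y (j k)‖ = ‖x (i k)‖) (hx : ∀ m ∉ Set.range i, x m = 0)
    (hy : ∀ m ∉ Set.range j, y m = 0) : decRearr y = decRearr x := by
  funext m
  unfold decRearr
  congr 1
  ext s
  exact ⟨exists_card_le_of_norm_eq hj (fun k => (h k).symm) hx,
    exists_card_le_of_norm_eq hi h hy⟩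

/-- The unit vectors of `l_∞`. -/
noncomputable def unitSeq (𝕜 : Type*) [RCLike 𝕜] (k : ℕ) : BddSeq 𝕜 := lp.single ∞ k 1

theorem unitSeq_apply_self (k : ℕ) : unitSeq 𝕜 k k = 1 := lp.single_apply_self _ _ _

theorem unitSeq_apply_of_ne {k l : ℕ} (h : l ≠ k) : unitSeq 𝕜 k l = 0 :=
  lp.single_apply_ne _ _ _ h

theorem decRearr_unitSeq (k l : ℕ) : decRearr (unitSeq 𝕜 k) = decRearr (unitSeq 𝕜 l) := by
  refine decRearr_eq_of_norm_eq (n := 1) (i := fun _ => l) (j := fun _ => k)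
    (Function.injective_of_subsingleton _) (Function.injective_of_subsingleton _) ?_ ?_ ?_
  · intro
    rw [unitSeq_apply_self, unitSeq_apply_self]
  · intro m hm
    exact unitSeq_apply_of_ne fun h => hm ⟨0, h.symm⟩
  · intro m hm
    exact unitSeq_apply_of_ne fun h => hm ⟨0, h.symm⟩

namespace SymmSeqSpace

variable {I : SymmSeqSpace 𝕜}

theorem unitSeq_mem (hI : I.ideal ≠ ⊥) (k : ℕ) : unitSeq 𝕜 k ∈ I.ideal := by
  obtain ⟨x, hx, hx0⟩ := (Submodule.ne_bot_iff _).1 hI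
  obtain ⟨l, hl⟩ : ∃ l, x l ≠ 0 := by
    by_contra! h
    exact hx0 (lp.ext (funext h))
  have h : unitSeq 𝕜 l = lp.single ∞ l (x l)⁻¹ * x := by
    apply lp.ext
    funext m
    rw [lp.infty_coeFn_mul, Pi.mul_apply]
    rcases eq_or_ne m l with rfl | hm
    · rw [unitSeq_apply_self, lp.single_apply_self, inv_mul_cancel₀ hl]
    · rw [unitSeq_apply_of_ne hm, lp.single_apply_ne _ _ _ hm, zero_mul]
  have hl' : unitSeq 𝕜 l ∈ I.ideal := h ▸ I.ideal.mul_mem_left _ hx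
  exact (I.symm ⟨_, hl'⟩ _ (decRearr_unitSeq k l)).1

/-- The unit vectors as elements of a nonzero symmetric sequence space. -/
noncomputable def unit (hI : I.ideal ≠ ⊥) (k : ℕ) : I.ideal := ⟨unitSeq 𝕜 k, unitSeq_mem hI k⟩

set_option synthInstance.maxHeartbeats 200000 in
theorem nrm_nonneg (y : I.ideal) : 0 ≤ I.nrm y := apply_nonneg I.nrm y

theorem nrm_unit (hI : I.ideal ≠ ⊥) (k : ℕ) : I.nrm (unit hI k) = I.nrm (unit hI 0) :=
  (I.symm (unit hI 0) _ (decRearr_unitSeq k 0)).2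

theorem nrm_unit_pos (hI : I.ideal ≠ ⊥) : 0 < I.nrm (unit hI 0) := by
  refine (nrm_nonneg _).lt_of_ne' fun h => ?_
  have h1 := congr_arg Subtype.val (I.eq_zero_of_nrm_eq_zero _ h)
  have h2 : unitSeq 𝕜 0 0 = 0 := by
    change (unit hI 0).1 0 = 0
    rw [h1]
    rfl
  rw [unitSeq_apply_self] at h2
  exact one_ne_zero h2

/-- The combination `∑ₖ a k • e (j k)` of unit vectors. -/
noncomputable def combo (hI : I.ideal ≠ ⊥) (a : Fin n → 𝕜) (j : Fin n → ℕ) : I.ideal :=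
  ∑ k, a k • unit hI (j k)

theorem coe_combo (hI : I.ideal ≠ ⊥) (a : Fin n → 𝕜) (j : Fin n → ℕ) (m : ℕ) :
    (combo hI a j : BddSeq 𝕜) m = ∑ k, a k * unitSeq 𝕜 (j k) m := by
  have h : (combo hI a j : BddSeq 𝕜) = ∑ k, a k • unitSeq 𝕜 (j k) := by
    rw [combo, AddSubmonoidClass.coe_finsetSum]
    rfl
  rw [h, lp.coeFn_sum, Finset.sum_apply]
  rfl

theorem combo_apply (hI : I.ideal ≠ ⊥) (a : Fin n → 𝕜) {j : Fin n → ℕ} (hj : j.Injective)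
    (k : Fin n) : (combo hI a j : BddSeq 𝕜) (j k) = a k := by
  rw [coe_combo, Finset.sum_eq_single k, unitSeq_apply_self, mul_one]
  · intro l _ hl
    rw [unitSeq_apply_of_ne (hj.ne hl.symm), mul_zero]
  · simp

theorem combo_apply_of_notMem (hI : I.ideal ≠ ⊥) (a : Fin n → 𝕜) {j : Fin n → ℕ}
    {m : ℕ} (hm : m ∉ Set.range j) : (combo hI a j : BddSeq 𝕜) m = 0 := by
  rw [coe_combo]
  refine Finset.sum_eq_zero fun l _ => ?_
  rw [unitSeq_apply_of_ne fun h => hm ⟨l, h.symm⟩, mul_zero]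

theorem mem_ideal (hI : I.ideal ≠ ⊥) {x : BddSeq 𝕜} (hx : ∀ k, n ≤ k → x k = 0) :
    x ∈ I.ideal := by
  have h : x = combo hI (fun k : Fin n => x k) (fun k => k) := by
    apply lp.ext
    funext m
    rcases lt_or_ge m n with hm | hm
    · exact (combo_apply hI (fun k : Fin n => x k) Fin.val_injective ⟨m, hm⟩).symm
    · rw [combo_apply_of_notMem, hx m hm]
      rintro ⟨k, rfl⟩
      exact absurd k.2 (not_lt.2 hm)
  rw [h]
  exact Subtype.mem _

theorem nrm_combo (hI : I.ideal ≠ ⊥) {x : BddSeq 𝕜} (hx : ∀ k, n ≤ k → x k = 0)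
    {a : Fin n → 𝕜} (ha : ∀ k, ‖a k‖ = ‖x k‖) {j : Fin n → ℕ} (hj : j.Injective) :
    I.nrm (combo hI a j) = I.nrm ⟨x, mem_ideal hI hx⟩ := by
  refine (I.symm ⟨x, mem_ideal hI hx⟩ (combo hI a j) ?_).2
  refine decRearr_eq_of_norm_eq (i := fun k : Fin n => (k : ℕ)) Fin.val_injective hj ?_ ?_ ?_
  · intro k
    rw [combo_apply hI a hj, ha]
  · intro m hm
    refine hx m (not_lt.1 fun h => hm ⟨⟨m, h⟩, rfl⟩)
  · exact fun m hm => combo_apply_of_notMem hI a hm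

/-- A crude bound that does not need `j` injective and does not depend on it; it controls the
non-injective maps. -/
theorem nrm_combo_le (hI : I.ideal ≠ ⊥) (a : Fin n → 𝕜) (j : Fin n → ℕ) :
    I.nrm (combo hI a j) ≤ (∑ k, ‖a k‖) * I.nrm (unit hI 0) := by
  rw [combo, Finset.sum_mul]
  refine (Finset.le_sum_of_subadditive I.nrm I.nrm.map_zero'.le (fun y z => I.nrm.add_le' y z)
    _ _).trans (Finset.sum_le_sum fun k _ => ?_)
  rw [← nrm_unit hI (j k)]
  exact (I.nrm.smul' _ _).le

end SymmSeqSpace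

end Sequences

/-! ### Weighted push-forwards, weak limits and the proportion of injective maps -/

section RandomOrlicz

theorem exists_probabilityMeasure_integral_eq {Ω X : Type*} [MeasurableSpace Ω] {μ : Measure Ω}
    [TopologicalSpace X] [TopologicalSpace.PseudoMetrizableSpace X] [SecondCountableTopology X]
    [MeasurableSpace X] [BorelSpace X] {w : Ω → ℝ} (hw : Measurable w) (hw0 : ∀ t, 0 ≤ w t)
    (hwi : Integrable w μ) (hpos : 0 < ∫ t, w t ∂μ) {F : Ω → X} (hF : Measurable F) :
    ∃ P : ProbabilityMeasure X, ∀ φ : X → ℝ, Continuous φ →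
      (∫ t, w t ∂μ) * ∫ m, φ m ∂(P : Measure X) = ∫ t, w t * φ (F t) ∂μ := by
  set Z := ∫ t, w t ∂μ with hZ
  set ρ := (μ.withDensity fun t => ENNReal.ofReal (w t / Z)) with hρ
  have hρ1 : ρ Set.univ = 1 := by
    rw [hρ, withDensity_apply _ MeasurableSet.univ, Measure.restrict_univ,
      ← ofReal_integral_eq_lintegral_ofReal (hwi.div_const Z)
        (Eventually.of_forall fun t => div_nonneg (hw0 t) hpos.le), integral_div, ← hZ,
      div_self hpos.ne', ENNReal.ofReal_one]
  have hprob : IsProbabilityMeasure ρ := ⟨hρ1⟩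
  refine ⟨⟨ρ.map F, Measure.isProbabilityMeasure_map hF.aemeasurable⟩, fun φ hφ => ?_⟩
  have h1 : ∫ m, φ m ∂(ρ.map F) = ∫ t, φ (F t) ∂ρ :=
    integral_map hF.aemeasurable hφ.stronglyMeasurable.aestronglyMeasurable
  change Z * ∫ m, φ m ∂(ρ.map F) = _
  rw [h1, hρ, integral_withDensity_eq_integral_toReal_smul (hw.div_const Z).ennreal_ofReal
    (Eventually.of_forall fun t => ENNReal.ofReal_lt_top), ← integral_const_mul]
  congr 1
  funext t
  rw [ENNReal.toReal_ofReal (div_nonneg (hw0 t) hpos.le), smul_eq_mul]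
  field_simp

/-- Probability measures on a compact metrizable space form a compact space. Along an ultrafilter, a
single limit works for every continuous `φ`. -/
theorem exists_tendsto_integral {X : Type*} [TopologicalSpace X] [CompactSpace X]
    [TopologicalSpace.MetrizableSpace X] [MeasurableSpace X] [BorelSpace X]
    (P : ℕ → ProbabilityMeasure X) :
    ∃ ν : ProbabilityMeasure X, ∀ φ : X → ℝ, Continuous φ →
      Tendsto (fun N => ∫ m, φ m ∂(P N : Measure X)) (hyperfilter ℕ : Filter ℕ)
        (𝓝 (∫ m, φ m ∂(ν : Measure X))) := by
  obtain ⟨ν, -, hν⟩ := (isCompact_univ (X := ProbabilityMeasure X)).ultrafilter_le_nhds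
    ((hyperfilter ℕ).map P) (by simp)
  refine ⟨ν, fun φ hφ => ?_⟩
  exact ProbabilityMeasure.tendsto_iff_forall_integral_tendsto.1 (show Tendsto P _ _ from hν)
    (BoundedContinuousFunction.mkOfCompact ⟨φ, hφ⟩)

/-- The proportion of injective maps among all maps `{0, …, n - 1} → {0, …, N - 1}`. -/
noncomputable def injProportion (n N : ℕ) : ℝ :=
  open Classical in 𝔼 j : Fin n → Fin N, if j.Injective then 1 else 0

theorem injProportion_eq (n N : ℕ) : injProportion n N = (N.descFactorial n : ℝ) / (N : ℝ) ^ n := by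
  classical
  rw [injProportion, Fintype.expect_eq_sum_div_card, Finset.sum_boole, Fintype.card_fun,
    Fintype.card_fin, Fintype.card_fin]
  have h : (Finset.univ.filter fun j : Fin n → Fin N => j.Injective).card = N.descFactorial n := by
    rw [← Fintype.card_subtype,
      Fintype.card_congr (Equiv.subtypeInjectiveEquivEmbedding (Fin n) (Fin N)),
      Fintype.card_embedding_eq, Fintype.card_fin, Fintype.card_fin]
  rw [Nat.cast_pow]
  congr 1
  exact_mod_cast h

theorem tendsto_injProportion (n : ℕ) : Tendsto (injProportion n) atTop (𝓝 1) := by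
  have h : Tendsto (fun N : ℕ => (1 - n / N : ℝ) ^ n) atTop (𝓝 1) := by
    have := ((tendsto_const_div_atTop_nhds_zero_nat (n : ℝ)).const_sub 1).pow n
    simpa using this
  refine tendsto_of_tendsto_of_tendsto_of_le_of_le' h tendsto_const_nhds ?_ ?_
  · filter_upwards [eventually_ge_atTop (n + 1)] with N hN
    have hN0 : (0 : ℝ) < N := Nat.cast_pos.2 (by omega)
    rw [injProportion_eq, le_div_iff₀ (by positivity), ← mul_pow]
    have h1 : (1 - n / N : ℝ) * N = ((N - n : ℕ) : ℝ) := by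
      rw [Nat.cast_sub (by omega)]
      field_simp
    rw [h1]
    exact_mod_cast (Nat.pow_le_pow_left (by omega) n).trans (Nat.pow_sub_le_descFactorial N n)
  · filter_upwards [eventually_gt_atTop 0] with N hN
    rw [injProportion_eq, div_le_one (by positivity)]
    exact_mod_cast Nat.descFactorial_le_pow N n

theorem injProportion_mul_le_expect {n N : ℕ} {H : (Fin n → Fin N) → ℝ} {A : ℝ}
    (h0 : ∀ j, 0 ≤ H j) (h : ∀ j, j.Injective → A ≤ H j) :
    injProportion n N * A ≤ 𝔼 j, H j := by
  rw [injProportion, Finset.expect_mul]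
  refine Finset.expect_le_expect fun j _ => ?_
  split_ifs with hj
  · simpa using h j hj
  · simpa using h0 j

theorem expect_le_injProportion {n N : ℕ} [NeZero N] {H : (Fin n → Fin N) → ℝ} {A K : ℝ}
    (hA : 0 ≤ A) (hK : ∀ j, H j ≤ K) (h : ∀ j, j.Injective → H j ≤ A) :
    𝔼 j, H j ≤ A + (1 - injProportion n N) * K := by
  classical
  have : A + (1 - injProportion n N) * K =
      𝔼 j : Fin n → Fin N, (A + (1 - if j.Injective then 1 else 0) * K) := by
    rw [Finset.expect_add_distrib, ← Finset.expect_mul, Finset.expect_sub_distrib,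
      Fintype.expect_const, Fintype.expect_const, injProportion]
  rw [this]
  refine Finset.expect_le_expect fun j _ => ?_
  split_ifs with hj
  · simpa using h j hj
  · have := hK j
    linarith

variable {p : ℝ} {N : ℕ} {Ω : Type*} [MeasurableSpace Ω]

theorem measurable_rpowGapSum {b : Fin N → Ω → ℝ} (hb : ∀ i, Measurable (b i)) (s : ℝ) :
    Measurable fun t => rpowGapSum p (fun i => b i t) s := by
  unfold rpowGapSum
  fun_prop

theorem measurable_expect_rpow {a : Fin N → Ω → ℝ} (ha : ∀ i, Measurable (a i)) :
    Measurable fun t => 𝔼 i, a i t ^ p := by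
  simp only [Fintype.expect_eq_sum_div_card]
  fun_prop

theorem measurable_sampleOrlicz (hp : 1 ≤ p) (hp2 : p ≤ 2) {a : Fin N → Ω → ℝ}
    (ha : ∀ i, Measurable (a i)) (ha0 : ∀ i t, 0 ≤ a i t) :
    Measurable fun t => sampleOrlicz hp hp2 fun i => a i t := by
  classical
  refine OrliczClass.measurable_of_apply fun s => ?_
  have hw := measurable_expect_rpow (p := p) ha
  have hb : ∀ i, Measurable fun t => a i t / (𝔼 i, a i t ^ p) ^ (1 / p) := fun i =>
    (ha i).div (hw.pow_const _)
  have h : (fun t => (sampleOrlicz hp hp2 (fun i => a i t)) s) = fun t =>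
      if 0 < 𝔼 i, a i t ^ p then
        (rpowGapSum p (fun i => a i t / (𝔼 i, a i t ^ p) ^ (1 / p)) 1)⁻¹ *
          rpowGapSum p (fun i => a i t / (𝔼 i, a i t ^ p) ^ (1 / p)) s
      else (samplingOrlicz hp hp2 (fun _ : Fin 1 => 1) (fun _ => zero_le_one) ⟨0, one_ne_zero⟩) s := by
    funext t
    unfold sampleOrlicz
    split_ifs with h1 h2 h2
    · rfl
    · exact absurd h1.2 h2
    · exact absurd ⟨fun i => ha0 i t, h2⟩ h1
    · rfl
  rw [h]
  refine Measurable.ite (measurableSet_lt measurable_const hw) ?_ measurable_const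
  exact (measurable_rpowGapSum hb 1).inv.mul (measurable_rpowGapSum hb s)

end RandomOrlicz

/-! ### Square functions of the embedded unit vectors -/

section Embedding

theorem integrable_expect {ι Ω : Type*} [Fintype ι] [MeasurableSpace Ω] {μ : Measure Ω}
    {f : ι → Ω → ℝ} (hf : ∀ i, Integrable (f i) μ) : Integrable (fun t => 𝔼 i, f i t) μ := by
  simp only [Fintype.expect_eq_sum_div_card]
  exact (integrable_finsetSum _ fun i _ => hf i).div_const _

theorem integral_expect {ι Ω : Type*} [Fintype ι] [MeasurableSpace Ω] {μ : Measure Ω}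
    {f : ι → Ω → ℝ} (hf : ∀ i, Integrable (f i) μ) : ∫ t, 𝔼 i, f i t ∂μ = 𝔼 i, ∫ t, f i t ∂μ := by
  simp only [Fintype.expect_eq_sum_div_card]
  rw [integral_div, integral_finsetSum _ fun i _ => hf i]

variable {𝕜 : Type*} [RCLike 𝕜] {p : ℝ} {Ω : Type*} [MeasurableSpace Ω] {μ : Measure Ω}

theorem norm_nonneg_Lp (g : Lp 𝕜 (ENNReal.ofReal p) μ) : 0 ≤ ‖g‖ := ENNReal.toReal_nonneg

theorem integrable_norm_rpow_Lp (hp : 0 < p) (g : Lp 𝕜 (ENNReal.ofReal p) μ) :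
    Integrable (fun t => ‖g t‖ ^ p) μ := by
  have := (Lp.memLp g).integrable_norm_rpow (ENNReal.ofReal_pos.2 hp).ne' ENNReal.ofReal_ne_top
  rwa [ENNReal.toReal_ofReal hp.le] at this

theorem integral_norm_rpow_Lp (hp : 0 < p) (g : Lp 𝕜 (ENNReal.ofReal p) μ) :
    ∫ t, ‖g t‖ ^ p ∂μ = ‖g‖ ^ p := by
  have h0 : 0 ≤ ∫ t, ‖g t‖ ^ p ∂μ := integral_nonneg fun t => by positivity
  rw [Lp.norm_def, (Lp.memLp g).eLpNorm_eq_integral_rpow_norm (ENNReal.ofReal_pos.2 hp).ne'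
    ENNReal.ofReal_ne_top, ENNReal.toReal_ofReal hp.le,
    ENNReal.toReal_ofReal (Real.rpow_nonneg h0 _), Real.rpow_inv_rpow h0 hp.ne']

namespace SymmSeqSpace

variable {I : SymmSeqSpace 𝕜} {n : ℕ}

/-- The modulus of the image of the `k`-th unit vector. -/
noncomputable def unitImage (hI : I.ideal ≠ ⊥) (T : I.ideal →ₗ[𝕜] Lp 𝕜 (ENNReal.ofReal p) μ)
    (k : ℕ) (t : Ω) : ℝ := ‖T (unit hI k) t‖

theorem measurable_unitImage (hI : I.ideal ≠ ⊥) (T : I.ideal →ₗ[𝕜] Lp 𝕜 (ENNReal.ofReal p) μ)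
    (k : ℕ) : Measurable (unitImage hI T k) :=
  (Lp.stronglyMeasurable (T (unit hI k))).measurable.norm

theorem unitImage_nonneg (hI : I.ideal ≠ ⊥) (T : I.ideal →ₗ[𝕜] Lp 𝕜 (ENNReal.ofReal p) μ)
    (k : ℕ) (t : Ω) : 0 ≤ unitImage hI T k t := norm_nonneg _

/-- The coefficients of `x` with the signs `σ`. -/
def signed (x : BddSeq 𝕜) (σ : Fin n → Bool) (k : Fin n) : 𝕜 := boolSign 𝕜 (σ k) * x k

theorem norm_signed (x : BddSeq 𝕜) (σ : Fin n → Bool) (k : Fin n) : ‖signed x σ k‖ = ‖x k‖ := by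
  rw [signed, norm_mul, norm_boolSign, one_mul]

theorem coeFn_map_combo (hI : I.ideal ≠ ⊥) (T : I.ideal →ₗ[𝕜] Lp 𝕜 (ENNReal.ofReal p) μ)
    (x : BddSeq 𝕜) (σ : Fin n → Bool) (j : Fin n → ℕ) :
    T (combo hI (signed x σ) j) =ᵐ[μ]
      fun t => signSum (fun k : Fin n => x k * T (unit hI (j k)) t) σ := by
  have h : T (combo hI (signed x σ) j) = ∑ k, signed x σ k • T (unit hI (j k)) := by
    rw [combo, map_sum]
    exact Finset.sum_congr rfl fun k _ => T.map_smul _ _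
  rw [h]
  have h2 : ∀ᵐ t ∂μ, ∀ k, (signed x σ k • T (unit hI (j k)) : Lp 𝕜 (ENNReal.ofReal p) μ) t =
      signed x σ k * T (unit hI (j k)) t :=
    ae_all_iff.2 fun k => Lp.coeFn_smul (signed x σ k) (T (unit hI (j k)))
  filter_upwards [Lp.coeFn_finsetSum Finset.univ fun k => signed x σ k • T (unit hI (j k)), h2]
    with t h1 h2
  rw [h1, Finset.sum_apply, signSum]
  refine Finset.sum_congr rfl fun k _ => ?_
  rw [h2, signed, mul_assoc]

/-- The square function `(∑ₖ |x k|² |T e (j k)|²)^(p/2)`. -/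
noncomputable def squareFun (hI : I.ideal ≠ ⊥) (T : I.ideal →ₗ[𝕜] Lp 𝕜 (ENNReal.ofReal p) μ)
    (x : BddSeq 𝕜) (j : Fin n → ℕ) (t : Ω) : ℝ :=
  (∑ k : Fin n, ‖x k‖ ^ 2 * unitImage hI T (j k) t ^ 2) ^ (p / 2)

theorem squareFun_nonneg (hI : I.ideal ≠ ⊥) (T : I.ideal →ₗ[𝕜] Lp 𝕜 (ENNReal.ofReal p) μ)
    (x : BddSeq 𝕜) (j : Fin n → ℕ) (t : Ω) : 0 ≤ squareFun hI T x j t := by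
  unfold squareFun
  positivity

theorem measurable_squareFun (hI : I.ideal ≠ ⊥) (T : I.ideal →ₗ[𝕜] Lp 𝕜 (ENNReal.ofReal p) μ)
    (x : BddSeq 𝕜) (j : Fin n → ℕ) : Measurable (squareFun hI T x j) := by
  have := measurable_unitImage hI T
  unfold squareFun
  fun_prop

theorem ae_squareFun_bounds (hI : I.ideal ≠ ⊥) (hp : 0 < p) (hp2 : p ≤ 2)
    (T : I.ideal →ₗ[𝕜] Lp 𝕜 (ENNReal.ofReal p) μ) (x : BddSeq 𝕜) (j : Fin n → ℕ) :
    ∀ᵐ t ∂μ, 𝔼 σ : Fin n → Bool, ‖T (combo hI (signed x σ) j) t‖ ^ p ≤ 2 * squareFun hI T x j t ∧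
      1 / 4 * squareFun hI T x j t ≤ 𝔼 σ : Fin n → Bool, ‖T (combo hI (signed x σ) j) t‖ ^ p := by
  filter_upwards [ae_all_iff.2 fun σ : Fin n → Bool => coeFn_map_combo hI T x σ j] with t ht
  have h : squareFun hI T x j t =
      (∑ k : Fin n, ‖x k * T (unit hI (j k)) t‖ ^ 2) ^ (p / 2) := by
    simp only [squareFun, unitImage, norm_mul, mul_pow]
  simp only [ht, h]
  exact khinchine hp hp2 _

theorem integrable_squareFun (hI : I.ideal ≠ ⊥) (hp : 0 < p) (hp2 : p ≤ 2)
    (T : I.ideal →ₗ[𝕜] Lp 𝕜 (ENNReal.ofReal p) μ) (x : BddSeq 𝕜) (j : Fin n → ℕ) :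
    Integrable (squareFun hI T x j) μ := by
  refine Integrable.mono' ((integrable_expect fun σ : Fin n → Bool =>
    integrable_norm_rpow_Lp hp (T (combo hI (signed x σ) j))).const_mul 4)
    (measurable_squareFun hI T x j).aestronglyMeasurable ?_
  filter_upwards [ae_squareFun_bounds hI hp hp2 T x j] with t ht
  rw [Real.norm_of_nonneg (squareFun_nonneg hI T x j t)]
  linarith [ht.2]

theorem integral_squareFun_bounds (hI : I.ideal ≠ ⊥) (hp : 0 < p) (hp2 : p ≤ 2)
    (T : I.ideal →ₗ[𝕜] Lp 𝕜 (ENNReal.ofReal p) μ) (x : BddSeq 𝕜) (j : Fin n → ℕ) :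
    𝔼 σ : Fin n → Bool, ‖T (combo hI (signed x σ) j)‖ ^ p ≤ 2 * ∫ t, squareFun hI T x j t ∂μ ∧
      ∫ t, squareFun hI T x j t ∂μ ≤
        4 * 𝔼 σ : Fin n → Bool, ‖T (combo hI (signed x σ) j)‖ ^ p := by
  have hi := fun σ : Fin n → Bool => integrable_norm_rpow_Lp hp (T (combo hI (signed x σ) j))
  have hS := integrable_squareFun hI hp hp2 T x j
  have hae := ae_squareFun_bounds hI hp hp2 T x j
  simp only [← integral_norm_rpow_Lp hp]
  rw [← integral_expect hi, ← integral_const_mul, ← integral_const_mul]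
  constructor
  · exact integral_mono_ae (integrable_expect hi) (hS.const_mul 2) (hae.mono fun t ht => ht.1)
  · refine integral_mono_ae hS ((integrable_expect hi).const_mul 4) (hae.mono fun t ht => ?_)
    linarith [ht.2]

variable {c C : ℝ} {T : I.ideal →ₗ[𝕜] Lp 𝕜 (ENNReal.ofReal p) μ}

theorem integral_squareFun_le (hI : I.ideal ≠ ⊥) (hp : 0 < p) (hp2 : p ≤ 2)
    (hTC : ∀ y, ‖T y‖ ≤ C * I.nrm y) (hC : 0 ≤ C) (x : BddSeq 𝕜) (j : Fin n → ℕ) :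
    ∫ t, squareFun hI T x j t ∂μ ≤
      4 * (C * ((∑ k : Fin n, ‖x k‖) * I.nrm (unit hI 0))) ^ p := by
  refine (integral_squareFun_bounds hI hp hp2 T x j).2.trans
    (mul_le_mul_of_nonneg_left ?_ (by norm_num))
  refine (Finset.expect_le_expect fun σ _ => ?_).trans_eq (Fintype.expect_const _)
  refine Real.rpow_le_rpow (norm_nonneg_Lp _) ((hTC _).trans ?_) hp.le
  refine mul_le_mul_of_nonneg_left ((nrm_combo_le hI _ _).trans_eq ?_) hC
  simp only [norm_signed]

theorem integral_squareFun_bounds_of_injective (hI : I.ideal ≠ ⊥) (hp : 0 < p) (hp2 : p ≤ 2)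
    (hTc : ∀ y, c * I.nrm y ≤ ‖T y‖) (hc : 0 ≤ c) (hTC : ∀ y, ‖T y‖ ≤ C * I.nrm y)
    {x : BddSeq 𝕜} (hx : ∀ k, n ≤ k → x k = 0) {j : Fin n → ℕ} (hj : j.Injective) :
    1 / 2 * (c * I.nrm ⟨x, mem_ideal hI hx⟩) ^ p ≤ ∫ t, squareFun hI T x j t ∂μ ∧
      ∫ t, squareFun hI T x j t ∂μ ≤ 4 * (C * I.nrm ⟨x, mem_ideal hI hx⟩) ^ p := by
  have h := integral_squareFun_bounds hI hp hp2 T x j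
  have hn : ∀ σ : Fin n → Bool, I.nrm (combo hI (signed x σ) j) = I.nrm ⟨x, mem_ideal hI hx⟩ :=
    fun σ => nrm_combo hI hx (norm_signed x σ) hj
  set R := I.nrm ⟨x, mem_ideal hI hx⟩
  have hR : 0 ≤ R := nrm_nonneg _
  constructor
  · have : (c * R) ^ p ≤ 𝔼 σ : Fin n → Bool, ‖T (combo hI (signed x σ) j)‖ ^ p := by
      rw [← Fintype.expect_const (ι := Fin n → Bool) ((c * R) ^ p)]
      refine Finset.expect_le_expect fun σ _ => ?_
      refine Real.rpow_le_rpow (mul_nonneg hc hR) ?_ hp.le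
      rw [← hn σ]
      exact hTc _
    linarith [h.1]
  · refine h.2.trans (mul_le_mul_of_nonneg_left ?_ (by norm_num))
    refine (Finset.expect_le_expect fun σ _ => ?_).trans_eq (Fintype.expect_const _)
    refine Real.rpow_le_rpow (norm_nonneg_Lp _) ?_ hp.le
    rw [← hn σ]
    exact hTC _

/-- The average of `|T e i|^p` over `i < N`. -/
noncomputable def weight (hI : I.ideal ≠ ⊥) (T : I.ideal →ₗ[𝕜] Lp 𝕜 (ENNReal.ofReal p) μ)
    (N : ℕ) (t : Ω) : ℝ := 𝔼 i : Fin N, unitImage hI T i t ^ p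

theorem weight_nonneg (hI : I.ideal ≠ ⊥) (T : I.ideal →ₗ[𝕜] Lp 𝕜 (ENNReal.ofReal p) μ)
    (N : ℕ) (t : Ω) : 0 ≤ weight hI T N t :=
  Finset.expect_nonneg fun i _ => Real.rpow_nonneg (unitImage_nonneg hI T i t) p

theorem measurable_weight (hI : I.ideal ≠ ⊥) (T : I.ideal →ₗ[𝕜] Lp 𝕜 (ENNReal.ofReal p) μ)
    (N : ℕ) : Measurable (weight hI T N) :=
  measurable_expect_rpow fun i : Fin N => measurable_unitImage hI T i

theorem integrable_weight (hI : I.ideal ≠ ⊥) (hp : 0 < p)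
    (T : I.ideal →ₗ[𝕜] Lp 𝕜 (ENNReal.ofReal p) μ) (N : ℕ) : Integrable (weight hI T N) μ :=
  integrable_expect fun i : Fin N => integrable_norm_rpow_Lp hp (T (unit hI i))

theorem integral_weight_bounds (hI : I.ideal ≠ ⊥) (hp : 0 < p) (hTc : ∀ y, c * I.nrm y ≤ ‖T y‖)
    (hc : 0 ≤ c) (hTC : ∀ y, ‖T y‖ ≤ C * I.nrm y) (N : ℕ) [NeZero N] :
    (c * I.nrm (unit hI 0)) ^ p ≤ ∫ t, weight hI T N t ∂μ ∧
      ∫ t, weight hI T N t ∂μ ≤ (C * I.nrm (unit hI 0)) ^ p := by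
  have h : ∫ t, weight hI T N t ∂μ = 𝔼 i : Fin N, ‖T (unit hI i)‖ ^ p := by
    simp only [← integral_norm_rpow_Lp hp]
    exact integral_expect fun i : Fin N => integrable_norm_rpow_Lp hp (T (unit hI i))
  rw [h]
  constructor
  · rw [← Fintype.expect_const (ι := Fin N) ((c * I.nrm (unit hI 0)) ^ p)]
    refine Finset.expect_le_expect fun i _ => ?_
    refine Real.rpow_le_rpow (mul_nonneg hc (nrm_unit_pos hI).le) ?_ hp.le
    rw [← nrm_unit hI i]
    exact hTc _
  · refine (Finset.expect_le_expect fun i _ => ?_).trans_eq (Fintype.expect_const _)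
    refine Real.rpow_le_rpow (norm_nonneg_Lp _) ?_ hp.le
    rw [← nrm_unit hI i]
    exact hTC _

theorem continuous_orliczNorm_rpow (hp : 0 ≤ p) {x : BddSeq 𝕜} (hx : ∀ k, n ≤ k → x k = 0) :
    Continuous fun M : OrliczClass p 2 => orliczNorm M x ^ p :=
  (Real.continuous_rpow_const hp).comp (OrliczClass.continuous_orliczNorm hx)

theorem integral_weight_mul_bounds (hI : I.ideal ≠ ⊥) (hp : 1 ≤ p) (hp2 : p ≤ 2)
    (hTc : ∀ y, c * I.nrm y ≤ ‖T y‖) (hc : 0 ≤ c) (hTC : ∀ y, ‖T y‖ ≤ C * I.nrm y) (hC : 0 ≤ C)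
    {x : BddSeq 𝕜} (hx : ∀ k, n ≤ k → x k = 0) (N : ℕ) [NeZero N] :
    injProportion n N * (1 / 2 * (c * I.nrm ⟨x, mem_ideal hI hx⟩) ^ p) ≤
        2 * ∫ t, weight hI T N t * orliczNorm
          (sampleOrlicz hp hp2 fun i : Fin N => unitImage hI T i t) x ^ p ∂μ ∧
      (2 ^ (p / 2) - 1) / 2 * ∫ t, weight hI T N t * orliczNorm
          (sampleOrlicz hp hp2 fun i : Fin N => unitImage hI T i t) x ^ p ∂μ ≤
        4 * (C * I.nrm ⟨x, mem_ideal hI hx⟩) ^ p + (1 - injProportion n N) *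
          (4 * (C * ((∑ k : Fin n, ‖x k‖) * I.nrm (unit hI 0))) ^ p) := by
  have hp0 : 0 < p := by linarith
  have hinj : ∀ {j : Fin n → Fin N}, j.Injective → (fun k => (j k : ℕ)).Injective :=
    fun hj => Fin.val_injective.comp hj
  have hi := fun j : Fin n → Fin N => integrable_squareFun hI hp0 hp2 T x fun k => (j k : ℕ)
  have hA : ∫ t, samplingAverage p (fun i : Fin N => unitImage hI T i t) x n ∂μ =
      𝔼 j : Fin n → Fin N, ∫ t, squareFun hI T x (fun k => (j k : ℕ)) t ∂μ := integral_expect hi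
  have hAi : Integrable (fun t => samplingAverage p (fun i : Fin N => unitImage hI T i t) x n) μ :=
    integrable_expect hi
  have hb := fun t => sampling_bounds hp hp2 (fun i : Fin N => unitImage_nonneg hI T i t) hx
  have hR : 0 ≤ I.nrm ⟨x, mem_ideal hI hx⟩ := nrm_nonneg _
  have hφ := continuous_orliczNorm_rpow (by linarith : 0 ≤ p) hx
  have hwi : Integrable (fun t => weight hI T N t * orliczNorm
      (sampleOrlicz hp hp2 fun i : Fin N => unitImage hI T i t) x ^ p) μ := by
    -- A continuous function on the compact `𝓞_{p,2}` is bounded, so its product with the integrable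
    -- weight is integrable.
    obtain ⟨B, hB⟩ := isCompact_univ.exists_bound_of_continuousOn hφ.continuousOn
    refine (integrable_weight hI hp0 T N).mul_bdd (c := B) ?_ ?_
    · exact (hφ.measurable.comp (measurable_sampleOrlicz hp hp2
        (fun i : Fin N => measurable_unitImage hI T i)
        fun i t => unitImage_nonneg hI T i t)).aestronglyMeasurable
    · exact Eventually.of_forall fun t => hB _ (Set.mem_univ _)
  constructor
  · refine (injProportion_mul_le_expect (fun j => integral_nonneg fun t =>
      squareFun_nonneg hI T x (fun k => (j k : ℕ)) t) fun j hj =>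
      (integral_squareFun_bounds_of_injective hI hp0 hp2 hTc hc hTC hx (hinj hj)).1).trans ?_
    rw [← hA, ← integral_const_mul]
    exact integral_mono hAi (hwi.const_mul 2) fun t => (hb t).1
  · refine le_trans ?_ (expect_le_injProportion (by positivity) (fun j =>
      integral_squareFun_le hI hp0 hp2 hTC hC x fun k => (j k : ℕ)) fun j hj =>
      (integral_squareFun_bounds_of_injective hI hp0 hp2 hTc hc hTC hx (hinj hj)).2)
    rw [← hA, ← integral_const_mul]
    exact integral_mono (hwi.const_mul _) hAi fun t => (hb t).2

end SymmSeqSpace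

end Embedding

/-! ### The limiting measure and the final estimate -/

section RandomOrliczRepresentation

variable {𝕜 : Type*} [RCLike 𝕜] {p : ℝ} {Ω : Type*} [MeasurableSpace Ω] {μ : Measure Ω}

theorem SymmSeqSpace.exists_probabilityMeasure_bounds {I : SymmSeqSpace 𝕜} (hI : I.ideal ≠ ⊥)
    (hp : 1 ≤ p) (hp2 : p ≤ 2) {T : I.ideal →ₗ[𝕜] Lp 𝕜 (ENNReal.ofReal p) μ} {c C : ℝ}
    (hc : 0 < c) (hC : 0 < C) (hTc : ∀ y, c * I.nrm y ≤ ‖T y‖) (hTC : ∀ y, ‖T y‖ ≤ C * I.nrm y) :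
    ∃ ν : ProbabilityMeasure (OrliczClass p 2), ∃ A B : ℝ, 0 < A ∧ 0 < B ∧
      ∀ (n : ℕ) (x : BddSeq 𝕜) (hx : ∀ k, n ≤ k → x k = 0),
        A * I.nrm ⟨x, mem_ideal hI hx⟩ ^ p ≤
            ∫ M : OrliczClass p 2, orliczNorm M x ^ p ∂(ν : Measure (OrliczClass p 2)) ∧
          ∫ M : OrliczClass p 2, orliczNorm M x ^ p ∂(ν : Measure (OrliczClass p 2)) ≤
            B * I.nrm ⟨x, mem_ideal hI hx⟩ ^ p := by
  have hp0 : 0 < p := by linarith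
  set u := I.nrm (unit hI 0) with hu
  have hu0 : 0 < u := nrm_unit_pos hI
  have hZ := fun N : ℕ => integral_weight_bounds hI hp0 hTc hc.le hTC (N + 1)
  have hα : 0 < (c * u) ^ p := by positivity
  have hβ : 0 < (C * u) ^ p := by positivity
  have hγ : 0 < ((2 : ℝ) ^ (p / 2) - 1) / 2 :=
    half_pos (sub_pos.2 (Real.one_lt_rpow one_lt_two (by linarith)))
  -- Sample size `N + 1` keeps the averages nonempty; the weight has positive integral by the lower
  -- bound on `T`.
  choose P hP using fun N : ℕ => exists_probabilityMeasure_integral_eq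
    (measurable_weight hI T (N + 1)) (weight_nonneg hI T (N + 1))
    (integrable_weight hI hp0 T (N + 1)) (hα.trans_le (hZ N).1)
    (measurable_sampleOrlicz hp hp2 (fun i : Fin (N + 1) => measurable_unitImage hI T i)
      fun i t => unitImage_nonneg hI T i t)
  obtain ⟨ν, hν⟩ := exists_tendsto_integral P
  -- In the limit the injective proportion is `1`, leaving `(c R)^p / 2 ≤ 2 (C u)^p J` and `(2^(p/2)
  -- - 1) / 2 * (c u)^p J ≤ 4 (C R)^p`, where `J` is the limiting integral and `R = ‖x‖_I`.
  refine ⟨ν, c ^ p / (4 * (C * u) ^ p), 4 * C ^ p / (((2 : ℝ) ^ (p / 2) - 1) / 2 * (c * u) ^ p),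
    by positivity, by positivity, fun n x hx => ?_⟩
  have hφ := continuous_orliczNorm_rpow hp0.le hx
  have hlim := hν _ hφ
  have hJ0 : ∀ N, 0 ≤ ∫ M : OrliczClass p 2, orliczNorm M x ^ p ∂(P N : Measure _) := fun N =>
    integral_nonneg fun M => Real.rpow_nonneg orliczNorm_nonneg p
  have hθ : Tendsto (fun N => injProportion n (N + 1)) (hyperfilter ℕ : Filter ℕ) (𝓝 1) :=
    ((tendsto_injProportion n).comp (tendsto_add_atTop_nat 1)).mono_left Nat.hyperfilter_le_atTop
  have hK := fun N : ℕ => integral_weight_mul_bounds hI hp hp2 hTc hc.le hTC hC.le hx (N + 1)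
  have hR : 0 ≤ I.nrm ⟨x, mem_ideal hI hx⟩ := nrm_nonneg _
  set R := I.nrm ⟨x, mem_ideal hI hx⟩
  constructor
  · have h := le_of_tendsto_of_tendsto (hθ.mul_const (1 / 2 * (c * R) ^ p))
      (hlim.const_mul (2 * (C * u) ^ p)) (Eventually.of_forall fun N => ?_)
    · rw [Real.mul_rpow hc.le hR] at h
      rw [div_mul_eq_mul_div, div_le_iff₀ (by positivity)]
      linarith
    · refine (hK N).1.trans ?_
      rw [← hP N _ hφ]
      have := mul_le_mul_of_nonneg_right (hZ N).2 (hJ0 N)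
      linarith
  · have h := le_of_tendsto_of_tendsto
      (hlim.const_mul (((2 : ℝ) ^ (p / 2) - 1) / 2 * (c * u) ^ p))
      (((hθ.const_sub 1).mul_const
        (4 * (C * ((∑ k : Fin n, ‖x k‖) * I.nrm (unit hI 0))) ^ p)).const_add (4 * (C * R) ^ p))
      (Eventually.of_forall fun N => ?_)
    · rw [Real.mul_rpow hC.le hR, sub_self, zero_mul, add_zero] at h
      rw [div_mul_eq_mul_div, le_div_iff₀ (by positivity)]
      linarith
    · refine le_trans ?_ (hK N).2
      beta_reduce
      rw [← hP N _ hφ, mul_assoc]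
      exact mul_le_mul_of_nonneg_left (mul_le_mul_of_nonneg_right (hZ N).1 (hJ0 N)) hγ.le

end RandomOrliczRepresentation

theorem mainTheorem7 {𝕜 : Type*} [RCLike 𝕜] (p : ℝ) (hp1 : 1 ≤ p) (hp2 : p ≤ 2) :
    CompactSpace (OrliczClass p 2) ∧ TopologicalSpace.MetrizableSpace (OrliczClass p 2) ∧
    ∀ I : SymmSeqSpace 𝕜, I.ideal ≠ ⊥ → I.EmbedsInLp p →
      ∃ ν : MeasureTheory.Measure (OrliczClass p 2),
        MeasureTheory.IsProbabilityMeasure ν ∧ ν.Regular ∧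
        ∃ C : ℝ, 0 < C ∧ ∀ x : BddSeq 𝕜, (Function.support fun k => x k).Finite →
          MeasureTheory.Integrable (fun M : OrliczClass p 2 => orliczNorm M x ^ p) ν ∧
          ∃ hx : x ∈ I.ideal,
            C * I.nrm ⟨x, hx⟩ ≤ (∫ M : OrliczClass p 2, orliczNorm M x ^ p ∂ν) ^ (1 / p) ∧
            (∫ M : OrliczClass p 2, orliczNorm M x ^ p ∂ν) ^ (1 / p) ≤ I.nrm ⟨x, hx⟩ / C := by
  refine ⟨inferInstance, inferInstance, fun I hI ⟨T, c, C, hc, hC, hT⟩ => ?_⟩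
  have hp0 : 0 < p := by linarith
  obtain ⟨ν, A, B, hA, hB, hν⟩ := SymmSeqSpace.exists_probabilityMeasure_bounds hI hp1 hp2 hc hC
    (fun y => (hT y).1) fun y => (hT y).2
  -- One constant serves both sides: it is at most `A ^ (1 / p)`, and its inverse is at least `B ^
  -- (1 / p)`.
  refine ⟨ν, inferInstance, inferInstance, min (A ^ (1 / p)) (B ^ (1 / p))⁻¹, by positivity,
    fun x hxs => ?_⟩
  obtain ⟨n, hn⟩ := hxs.bddAbove
  have hx : ∀ k, n + 1 ≤ k → x k = 0 := by
    intro k hk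
    by_contra h
    have := hn (show k ∈ Function.support fun k => x k from h)
    omega
  refine ⟨?_, SymmSeqSpace.mem_ideal hI hx, ?_⟩
  · exact (SymmSeqSpace.continuous_orliczNorm_rpow hp0.le hx).integrable_of_hasCompactSupport
      (HasCompactSupport.of_compactSpace _)
  obtain ⟨h1, h2⟩ := hν _ x hx
  have hR : 0 ≤ I.nrm ⟨x, SymmSeqSpace.mem_ideal hI hx⟩ := SymmSeqSpace.nrm_nonneg _
  set R := I.nrm ⟨x, SymmSeqSpace.mem_ideal hI hx⟩
  have hRp : ∀ a : ℝ, 0 ≤ a → (a * R ^ p) ^ (1 / p) = a ^ (1 / p) * R := by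
    intro a ha
    rw [Real.mul_rpow ha (by positivity), one_div, Real.rpow_rpow_inv hR hp0.ne']
  have hB' : 0 < B ^ (1 / p) := by positivity
  constructor
  · refine le_trans ?_ (Real.rpow_le_rpow (by positivity) h1 (by positivity))
    rw [hRp A hA.le]
    exact mul_le_mul_of_nonneg_right (min_le_left _ _) hR
  · refine (Real.rpow_le_rpow (le_trans (by positivity) h1) h2 (by positivity)).trans ?_
    rw [hRp B hB.le, le_div_iff₀ (by positivity)]
    have h3 : B ^ (1 / p) * min (A ^ (1 / p)) (B ^ (1 / p))⁻¹ ≤ 1 :=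
      (mul_le_mul_of_nonneg_left (min_le_right _ _) hB'.le).trans_eq (mul_inv_cancel₀ hB'.ne')
    calc _ = (B ^ (1 / p) * min (A ^ (1 / p)) (B ^ (1 / p))⁻¹) * R := by ring
      _ ≤ R := mul_le_of_le_one_left hR h3
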